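/- **Theorem.** Let $m\ge 1$ be an integer and $\mathbf Q=(Q_1,\dots,Q_{m-1})\in\mathbb C^{m-1}$. Let $\mathfrak{sl}_m^{\langle\mathbf Q\rangle}[x]$ be the complex Lie algebra with generators $X^{\pm}_{i,t}$, $J_{i,t}$ ($1\le i\le m-1$, $t\ge 0$) and defining relations (for all indices for which the symbols make sense) - $[J_{i,s},J_{j,t}]=0$, $\quad [J_{j,s},X^{\pm}_{i,t}]=\pm a_{ji}X^{\pm}_{i,s+t}$, - $[X^+_{i,t},X^-_{j,s}]=\delta_{ij}\,(J_{i,s+t}-Q_iJ_{i,s+t+1})$, - $[X^{\pm}_{i,t},X^{\pm}_{j,s}]=0$ if $j\ne i\pm1$, - $[X^{+}_{i,t+1},X^{+}_{j,s}]=[X^{+}_{i,t},X^{+}_{j,s+1}]$ and $[X^{-}_{i,t+1},X^{-}_{j,s}]=[X^{-}_{i,t},X^{-}_{j,s+1}]$ if $j=i\pm1$, - $[X^{+}_{i,s},[X^{+}_{i,t},X^{+}_{j,u}]]=[X^{-}_{i,s},[X^{-}_{i,t},X^{-}_{j,u}]]=0$ if $j=i\pm1$, where $a_{ii}=2$, $a_{ji}=-1$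 if $j=i\pm1$, and $a_{ji}=0$ otherwise. Let $U$ be its universal enveloping algebra. For $\mathbf u=(u_{i,t})_{1\le i\le m-1,\,t\ge0}$ in $\mathbb C$, a $U$-module has highest weight $\mathbf u$ if it is generated by a nonzero vector $v_0$ with $X^+_{i,t}v_0=0$ and $J_{i,t}v_0=u_{i,t}v_0$ for all $i,t$. Let $M(\mathbf u)$ be the quotient of $U$ by the left ideal generated by all $X^+_{i,t}$ and all $J_{i,t}-u_{i,t}$, let $\operatorname{rad}M(\mathbf u)$ be its unique maximal proper submodule (the sum of all proper submodules), and put $L(\mathbf u)=M(\mathbf u)/\operatorname{rad}M(\mathbf u)$. Let $P$ be the set of tuples $(\varphi,\beta)=((\varphi_i,\beta_i))_{1\le i\le m-1}$, where $\varphi_i\in\mathbb C[x]$ is monic and $\beta_i\in\mathbb C$, such that for each $i$: if $Q_i\neq0$, then $Q_i^{-1}$ is not a root of $\varphi_i$; if $Q_i=0$, then $\beta_i=0$. For $(\varphi,\beta)\in P$ with $\varphi_i=(x-\gamma_{i,1})\cdots(x-\gamma_{i,n_i})$, define $\mathbf u^{\langle\mathbf Q\rangle}(\varphi,\beta)$ by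 $$u^{\langle\mathbf Q\rangle}(\varphi,\beta)_{i,t}=\begin{cases}\deg\varphi_i+\beta_i & t=0,\\ \gamma_{i,1}^t+\dots+\gamma_{i,n_i}^t & t>0,\ Q_i=0,\\ \gamma_{i,1}^t+\dots+\gamma_{i,n_i}^t+Q_i^{-t}\beta_i & t>0,\ Q_i\neq0.\end{cases}$$ Then: 1. For every $(\varphi,\beta)\in P$, the module $L(\mathbf u^{\langle\mathbf Q\rangle}(\varphi,\beta))$ is simple, has highest weight $\mathbf u^{\langle\mathbf Q\rangle}(\varphi,\beta)$, and is finite dimensional over $\mathbb C$. 2. For $(\varphi,\beta),(\varphi',\beta')\in P$, $L(\mathbf u^{\langle\mathbf Q\rangle}(\varphi,\beta))\cong L(\mathbf u^{\langle\mathbf Q\rangle}(\varphi',\beta'))$ as $U$-modules if and only if $(\varphi,\beta)=(\varphi',\beta')$. 3. Every finite dimensional simple $U$-module is isomorphic to $L(\mathbf u^{\langle\mathbf Q\rangle}(\varphi,\beta))$ for some $(\varphi,\beta)\in P$. Hence the modules $L(\mathbf u^{\langle\mathbf Q\rangle}(\varphi,\beta))$, $(\varphi,\beta)\in P$, form a complete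 set of isomorphism classes of finite dimensional simple $U$-modules. -/

import Mathlib

open Polynomial

noncomputable section

namespace DeformedCurrent

/-- Generators of the deformed current Lie algebra of rank `n` (that is, of type `sl_{n+1}`):
`Xp i t`, `Xm i t`, `J i t` stand for `X⁺_{i,t}`, `X⁻_{i,t}`, `J_{i,t}`. -/
inductive Gen (n : ℕ) : Type
  | Xp (i : Fin n) (t : ℕ)
  | Xm (i : Fin n) (t : ℕ)
  | J (i : Fin n) (t : ℕ)

/-- `j = i ± 1`. -/
def Adj {n : ℕ} (i j : Fin n) : Prop :=
  (j : ℕ) = (i : ℕ) + 1 ∨ (i : ℕ) = (j : ℕ) + 1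

open Classical in
/-- The entries of the Cartan matrix of type `A_n`. -/
def cartan {n : ℕ} (j i : Fin n) : ℂ :=
  if j = i then 2 else if Adj i j then -1 else 0

/-- The free Lie algebra over `ℂ` on the generators. -/
abbrev Free (n : ℕ) : Type := FreeLieAlgebra ℂ (Gen n)

/-- `X⁺_{i,t}` in the free Lie algebra. -/
def Free.Xp {n : ℕ} (i : Fin n) (t : ℕ) : Free n := FreeLieAlgebra.of ℂ (Gen.Xp i t)

/-- `X⁻_{i,t}` in the free Lie algebra. -/
def Free.Xm {n : ℕ} (i : Fin n) (t : ℕ) : Free n := FreeLieAlgebra.of ℂ (Gen.Xm i t)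

/-- `J_{i,t}` in the free Lie algebra. -/
def Free.J {n : ℕ} (i : Fin n) (t : ℕ) : Free n := FreeLieAlgebra.of ℂ (Gen.J i t)

open Free in
/-- The defining relations: `Rel Q a b` says that `a = b` is one of them. -/
inductive Rel {n : ℕ} (Q : Fin n → ℂ) : Free n → Free n → Prop
  | L1 (i j : Fin n) (s t : ℕ) : Rel Q ⁅J i s, J j t⁆ 0
  | L2p (i j : Fin n) (s t : ℕ) : Rel Q ⁅J j s, Xp i t⁆ (cartan j i • Xp i (s + t))
  | L2m (i j : Fin n) (s t : ℕ) : Rel Q ⁅J j s, Xm i t⁆ (-(cartan j i • Xm i (s + t)))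
  | L3_same (i : Fin n) (s t : ℕ) :
      Rel Q ⁅Xp i t, Xm i s⁆ (J i (s + t) - Q i • J i (s + t + 1))
  | L3_ne (i j : Fin n) (s t : ℕ) (h : i ≠ j) : Rel Q ⁅Xp i t, Xm j s⁆ 0
  | L4p (i j : Fin n) (s t : ℕ) (h : ¬ Adj i j) : Rel Q ⁅Xp i t, Xp j s⁆ 0
  | L4m (i j : Fin n) (s t : ℕ) (h : ¬ Adj i j) : Rel Q ⁅Xm i t, Xm j s⁆ 0
  | L5p (i j : Fin n) (s t : ℕ) (h : Adj i j) :
      Rel Q ⁅Xp i (t + 1), Xp j s⁆ ⁅Xp i t, Xp j (s + 1)⁆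
  | L5m (i j : Fin n) (s t : ℕ) (h : Adj i j) :
      Rel Q ⁅Xm i (t + 1), Xm j s⁆ ⁅Xm i t, Xm j (s + 1)⁆
  | L6p (i j : Fin n) (s t k : ℕ) (h : Adj i j) : Rel Q ⁅Xp i s, ⁅Xp i t, Xp j k⁆⁆ 0
  | L6m (i j : Fin n) (s t k : ℕ) (h : Adj i j) : Rel Q ⁅Xm i s, ⁅Xm i t, Xm j k⁆⁆ 0

/-- The Lie ideal of the free Lie algebra generated by the defining relations. -/
def relIdeal {n : ℕ} (Q : Fin n → ℂ) : LieIdeal ℂ (Free n) :=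
  LieSubmodule.lieSpan ℂ (Free n) {x | ∃ a b, Rel Q a b ∧ x = a - b}

/-- The deformed current Lie algebra `sl_{n+1}^{⟨Q⟩}[x]`. -/
abbrev DefSl {n : ℕ} (Q : Fin n → ℂ) : Type := Free n ⧸ relIdeal Q

/-- The universal enveloping algebra `U(sl_{n+1}^{⟨Q⟩}[x])`. -/
abbrev U {n : ℕ} (Q : Fin n → ℂ) : Type := UniversalEnvelopingAlgebra ℂ (DefSl Q)

/-- The canonical map from the free Lie algebra on the generators to the enveloping algebra. -/
def toU {n : ℕ} (Q : Fin n → ℂ) (x : Free n) : U Q :=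
  UniversalEnvelopingAlgebra.ι ℂ (LieSubmodule.Quotient.mk (N := relIdeal Q) x)

/-- `X⁺_{i,t}` in the enveloping algebra. -/
def U.Xp {n : ℕ} (Q : Fin n → ℂ) (i : Fin n) (t : ℕ) : U Q := toU Q (Free.Xp i t)

/-- `X⁻_{i,t}` in the enveloping algebra. -/
def U.Xm {n : ℕ} (Q : Fin n → ℂ) (i : Fin n) (t : ℕ) : U Q := toU Q (Free.Xm i t)

/-- `J_{i,t}` in the enveloping algebra. -/
def U.J {n : ℕ} (Q : Fin n → ℂ) (i : Fin n) (t : ℕ) : U Q := toU Q (Free.J i t)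

/-- `M` is a highest weight module of highest weight `u`: it is generated by a nonzero vector
killed by all `X⁺_{i,t}`, on which `J_{i,t}` acts by the scalar `u i t`. -/
def IsHighestWeight {n : ℕ} (Q : Fin n → ℂ) (u : Fin n → ℕ → ℂ)
    (M : Type*) [AddCommGroup M] [Module (U Q) M] : Prop :=
  ∃ v : M, v ≠ 0 ∧ Submodule.span (U Q) {v} = ⊤ ∧
    (∀ i t, U.Xp Q i t • v = 0) ∧
    (∀ i t, U.J Q i t • v = algebraMap ℂ (U Q) (u i t) • v)

/-- The left ideal generated by all `X⁺_{i,t}` and all `J_{i,t} - u_{i,t}`. -/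
def vermaIdeal {n : ℕ} (Q : Fin n → ℂ) (u : Fin n → ℕ → ℂ) : Submodule (U Q) (U Q) :=
  Submodule.span (U Q)
    ({x | ∃ i t, x = U.Xp Q i t} ∪ {x | ∃ i t, x = U.J Q i t - algebraMap ℂ (U Q) (u i t)})

/-- The Verma module of highest weight `u`. -/
abbrev Verma {n : ℕ} (Q : Fin n → ℂ) (u : Fin n → ℕ → ℂ) : Type := U Q ⧸ vermaIdeal Q u

/-- The radical of the Verma module: the sum of all its proper submodules (this is its unique
maximal proper submodule). -/
def vermaRad {n : ℕ} (Q : Fin n → ℂ) (u : Fin n → ℕ → ℂ) : Submodule (U Q) (Verma Q u) :=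
  sSup {N | N ≠ ⊤}

/-- The module `L(u)`: the Verma module of highest weight `u` modulo its radical. -/
abbrev Simple {n : ℕ} (Q : Fin n → ℂ) (u : Fin n → ℕ → ℂ) : Type := Verma Q u ⧸ vermaRad Q u

/-- The monic complex polynomials which, if `q ≠ 0`, do not have `q⁻¹` as a root. -/
def MonicSet (q : ℂ) : Set ℂ[X] := {φ | φ.Monic ∧ (q ≠ 0 → ¬ φ.IsRoot q⁻¹)}

/-- `ℂ` if `q ≠ 0`, and `{0}` if `q = 0`. -/
def BSet (q : ℂ) : Set ℂ := {β | q = 0 → β = 0}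

/-- The set of parameters `(φ, β) = ((φ_i, β_i))_i`. -/
abbrev Param {n : ℕ} (Q : Fin n → ℂ) : Type := (i : Fin n) → MonicSet (Q i) × BSet (Q i)

/-- The sum of the `t`-th powers of the complex roots of `φ`, with multiplicity. -/
def powerSum (φ : ℂ[X]) (t : ℕ) : ℂ := (φ.roots.map (fun γ => γ ^ t)).sum

open Classical in
/-- The highest weight `u^{⟨Q⟩}(φ, β)`. -/
def weight {n : ℕ} (Q : Fin n → ℂ) (p : Param Q) (i : Fin n) (t : ℕ) : ℂ :=
  if t = 0 then (((p i).1 : ℂ[X]).natDegree : ℂ) + ((p i).2 : ℂ)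
  else if Q i = 0 then powerSum (p i).1 t
  else powerSum (p i).1 t + ((Q i) ^ t)⁻¹ * ((p i).2 : ℂ)

end DeformedCurrent

end

/-!
The finite dimensional simple modules are classified by highest weights; the two points to settle
are which weights occur and that the modules `L(u)` behave as expected although no PBW theorem is
available.

*Highest weight theory.* The combination `ht` of the `J_{j,0}` with the coefficients of `ρ^∨` acts
on `X^±_{i,t}` by `±1`, so it grades every highest weight module by height. The commutation
relations alone show that a module generated by singular vectors is spanned by the images of these
vectors under products of `X⁻_{i,t}` (`IsSingular.span_le_iSup_descend`). Hence the top height space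
of a highest weight module is a line, its proper submodules have a proper sum
(`IsHWVector.sSup_ne_top`), and its weight is an isomorphism invariant (`IsHWVector.eq_of_equiv`).
So `L(u)` is simple as soon as some module contains a nonzero highest weight vector of weight `u`,
it is finite dimensional if that module is, and a simple module with such a vector is isomorphic to
`L(u)`.

*The weights `u(φ, β)` occur.* The algebra maps to `sl_{n+1}[x]` by `X⁺_{i,t} ↦ x^t e_i`,
`X⁻_{i,t} ↦ (1 - Q_i x) x^t f_i`, `J_{i,t} ↦ x^t h_i`, and it has the characters
`J_{i,t} ↦ Q_i^{-t} β_i`, `X^±_{i,t} ↦ 0`. A tensor product of fundamental representations evaluated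
at the roots of the `φ_i`, twisted by a character, is needed. It sits inside the exterior algebra of
a direct sum of evaluated vector representations, with one summand for each root. There the action
is given by creation and annihilation operators (`secondQuantLie`), and the wedge product of the
appropriate basis vectors is the highest weight vector (`exists_fockRep_highestWeight`).

*No other weights occur.* Let `v` be a highest weight vector of a finite dimensional simple module.
The polynomials `f` with `X⁻_i(f) v = 0` form a nonzero ideal (`annIdeal`); by simplicity it contains
every `f` with `w(f g) = 0` for all `g`, where `w(f) = u_i((1 - Q_i x) f)`. An `sl_2` computation
along the string `X⁻_i(f)^r v` (`exists_coweight_eq_nat_mul`) shows first that this ideal is radical,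
so that `w` is a combination of evaluations at finitely many points `z`, and then, for Lagrange
polynomials `f`, that the coefficients are natural multiples of `1 - Q_i z`. Undoing the
multiplication by `1 - Q_i x` leaves a multiple of the evaluation at `Q_i⁻¹`, which is the parameter
`β_i`.

Finally the weight determines the parameters because evaluations at distinct points are linearly
independent (`param_eq_of_weight_eq`).
-/

noncomputable section

attribute [local instance 100] LieRing.ofAssociativeRing

namespace DeformedCurrent

/-! ### The enveloping algebra by generators and relations -/

section Generators

variable {n : ℕ} (Q : Fin n → ℂ)

/-- `toU` as a homomorphism of Lie algebras. -/
def toULie : Free n →ₗ⁅ℂ⁆ U Q where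
  toFun := toU Q
  map_add' x y := by
    simp only [toU]
    rw [← map_add]; rfl
  map_smul' c x := by
    simp only [toU, RingHom.id_apply]
    rw [← map_smul]; rfl
  map_lie' := by
    intro x y
    simp only [toU]
    rw [← LieHom.map_lie]; rfl

theorem toULie_apply (x : Free n) : toULie Q x = toU Q x := rfl

theorem toU_lie (x y : Free n) : toU Q ⁅x, y⁆ = toU Q x * toU Q y - toU Q y * toU Q x := by
  rw [← toULie_apply, LieHom.map_lie, LieRing.of_associative_ring_bracket]; rfl

theorem toU_eq_of_rel {a b : Free n} (h : Rel Q a b) : toU Q a = toU Q b := by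
  have : (LieSubmodule.Quotient.mk (N := relIdeal Q) a) = LieSubmodule.Quotient.mk b := by
    rw [← sub_eq_zero]
    have h2 : a - b ∈ relIdeal Q := LieSubmodule.subset_lieSpan ⟨a, b, h, rfl⟩
    exact (LieSubmodule.Quotient.mk_eq_zero' (N := relIdeal Q)).2 h2
  simp only [toU, this]

/-- The universal property of `U Q`: a map from the free Lie algebra to an associative algebra that
respects the defining relations extends to `U Q`. -/
theorem exists_algHom_of_rel {A : Type*} [Ring A] [Algebra ℂ A] (F : Free n →ₗ⁅ℂ⁆ A)
    (hF : ∀ a b, Rel Q a b → F a = F b) : ∃ Φ : U Q →ₐ[ℂ] A, ∀ x, Φ (toU Q x) = F x := by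
  have hle : relIdeal Q ≤ F.ker := by
    rw [relIdeal, LieSubmodule.lieSpan_le]
    rintro x ⟨a, b, h, rfl⟩
    simp [LieHom.mem_ker, hF a b h]
  let G : DefSl Q →ₗ⁅ℂ⁆ A :=
    { Submodule.liftQ (relIdeal Q).toSubmodule (F : Free n →ₗ[ℂ] A) hle with
      map_lie' := by
        intro x y
        obtain ⟨x, rfl⟩ := Submodule.Quotient.mk_surjective _ x
        obtain ⟨y, rfl⟩ := Submodule.Quotient.mk_surjective _ y
        exact F.map_lie x y }
  refine ⟨UniversalEnvelopingAlgebra.lift ℂ G, fun x => ?_⟩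
  rw [toU, UniversalEnvelopingAlgebra.lift_ι_apply]
  rfl

/-- The image in `U Q` of a generator. -/
def genU (g : Gen n) : U Q := toU Q (FreeLieAlgebra.of ℂ g)

theorem adjoin_range_genU : Algebra.adjoin ℂ (Set.range (genU Q)) = ⊤ := by
  set B := Algebra.adjoin ℂ (Set.range (genU Q)) with hB
  let φ : Free n →ₗ⁅ℂ⁆ B :=
    FreeLieAlgebra.lift ℂ (fun g => ⟨genU Q g, Algebra.subset_adjoin ⟨g, rfl⟩⟩)
  have hφ : ∀ x, (φ x : U Q) = toU Q x := by
    have : (B.val : B →ₗ⁅ℂ⁆ U Q).comp φ = toULie Q := by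
      apply FreeLieAlgebra.hom_ext
      intro g
      simp only [LieHom.comp_apply, φ, FreeLieAlgebra.lift_of_apply]
      rfl
    intro x
    exact congrArg (fun f => f x) this
  obtain ⟨Φ, hΦ⟩ := exists_algHom_of_rel Q φ (fun a b h => by
    apply Subtype.ext
    rw [hφ, hφ, toU_eq_of_rel Q h])
  have hid : B.val.comp Φ = AlgHom.id ℂ (U Q) := by
    apply UniversalEnvelopingAlgebra.hom_ext
    ext x
    obtain ⟨x, rfl⟩ := Submodule.Quotient.mk_surjective _ x
    change (Φ (toU Q x) : U Q) = toU Q x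
    rw [hΦ, hφ]
  rw [eq_top_iff]
  intro a _
  have : (Φ a : U Q) = a := congrArg (fun f => f a) hid
  rw [← this]
  exact (Φ a).2

theorem smul_mem_of_stable {V : Type*} [AddCommGroup V] [Module ℂ V] [Module (U Q) V]
    [IsScalarTower ℂ (U Q) V] (S : Submodule ℂ V)
    (hp : ∀ i t, ∀ x ∈ S, U.Xp Q i t • x ∈ S) (hm : ∀ i t, ∀ x ∈ S, U.Xm Q i t • x ∈ S)
    (hj : ∀ i t, ∀ x ∈ S, U.J Q i t • x ∈ S) (a : U Q) : ∀ x ∈ S, a • x ∈ S := by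
  have ha : a ∈ Algebra.adjoin ℂ (Set.range (genU Q)) := by
    rw [adjoin_range_genU]; trivial
  induction ha using Algebra.adjoin_induction with
  | mem a h =>
    obtain ⟨g, rfl⟩ := h
    cases g with
    | Xp i t => exact hp i t
    | Xm i t => exact hm i t
    | J i t => exact hj i t
  | algebraMap r => intro x hx; rw [algebraMap_smul]; exact S.smul_mem r hx
  | add a b _ _ ha hb => intro x hx; rw [add_smul]; exact S.add_mem (ha x hx) (hb x hx)
  | mul a b _ _ ha hb => intro x hx; rw [mul_smul]; exact ha _ (hb x hx)

/-! ### Relations in the enveloping algebra -/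

theorem U.J_mul_J (i j : Fin n) (s t : ℕ) : U.J Q i s * U.J Q j t = U.J Q j t * U.J Q i s := by
  have h := toU_eq_of_rel Q (Rel.L1 i j s t)
  rw [toU_lie, ← toULie_apply Q 0, map_zero] at h
  exact sub_eq_zero.1 h

theorem U.J_mul_Xp (i j : Fin n) (s t : ℕ) :
    U.J Q j s * U.Xp Q i t = U.Xp Q i t * U.J Q j s + cartan j i • U.Xp Q i (s + t) := by
  have h := toU_eq_of_rel Q (Rel.L2p i j s t)
  rw [toU_lie, ← toULie_apply Q (_ • _), map_smul] at h
  rw [← sub_eq_iff_eq_add']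
  exact h

theorem U.J_mul_Xm (i j : Fin n) (s t : ℕ) :
    U.J Q j s * U.Xm Q i t = U.Xm Q i t * U.J Q j s - cartan j i • U.Xm Q i (s + t) := by
  have h := toU_eq_of_rel Q (Rel.L2m i j s t)
  rw [toU_lie, ← toULie_apply Q (-(_ • _)), map_neg, map_smul] at h
  rw [sub_eq_add_neg, ← sub_eq_iff_eq_add']
  exact h

theorem U.Xp_mul_Xm_same (i : Fin n) (s t : ℕ) :
    U.Xp Q i t * U.Xm Q i s =
      U.Xm Q i s * U.Xp Q i t + (U.J Q i (s + t) - Q i • U.J Q i (s + t + 1)) := by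
  have h := toU_eq_of_rel Q (Rel.L3_same i s t)
  rw [toU_lie, ← toULie_apply Q (_ - _), map_sub, map_smul] at h
  rw [← sub_eq_iff_eq_add']
  exact h

theorem U.Xp_mul_Xm_ne {i j : Fin n} (hij : i ≠ j) (s t : ℕ) :
    U.Xp Q i t * U.Xm Q j s = U.Xm Q j s * U.Xp Q i t := by
  have h := toU_eq_of_rel Q (Rel.L3_ne i j s t hij)
  rw [toU_lie, ← toULie_apply Q 0, map_zero] at h
  exact sub_eq_zero.1 h

theorem U.Xm_mul_Xm_same (i : Fin n) (s t : ℕ) :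
    U.Xm Q i t * U.Xm Q i s = U.Xm Q i s * U.Xm Q i t := by
  have h := toU_eq_of_rel Q (Rel.L4m i i s t (by unfold Adj; omega))
  rw [toU_lie, ← toULie_apply Q 0, map_zero] at h
  exact sub_eq_zero.1 h

/-! ### The height element -/

/-- The coefficients `(j + 1) (n - j) / 2` of `ρ^∨` on the simple coroots. -/
def heightCoeff (n j : ℕ) : ℂ := ((j : ℂ) + 1) * ((n : ℂ) - j) / 2

/-- The element `∑ c_j J_{j,0}` with `c` the coefficients of `ρ^∨`: it acts on `X^±_{i,t}` by `±1`,
for all `i` and `t`. -/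
def ht : U Q := ∑ j : Fin n, heightCoeff n j • U.J Q j 0

theorem sum_heightCoeff_mul_cartan (i : Fin n) :
    ∑ j : Fin n, heightCoeff n j * cartan j i = 1 := by
  have key : ∀ j : Fin n, heightCoeff n j * cartan j i =
      (if (j : ℕ) = i then 2 * heightCoeff n i else 0) -
      (if (j : ℕ) = i + 1 then heightCoeff n (i + 1) else 0) -
      (if (j : ℕ) + 1 = i then heightCoeff n (i - 1 : ℕ) else 0) := by
    intro j
    unfold cartan Adj
    have hij : j = i ↔ (j : ℕ) = i := Fin.ext_iff
    by_cases h1 : (j : ℕ) = i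
    · have h2 : ¬ ((j : ℕ) = i + 1) := by omega
      have h3 : ¬ ((j : ℕ) + 1 = i) := by omega
      rw [if_pos (hij.2 h1), if_pos h1, if_neg h2, if_neg h3, h1]
      ring
    · by_cases h2 : (j : ℕ) = i + 1
      · have h3 : ¬ ((j : ℕ) + 1 = i) := by omega
        rw [if_neg (mt hij.1 h1), if_pos (Or.inl h2), if_neg h1, if_pos h2, if_neg h3, h2]
        ring
      · by_cases h3 : (j : ℕ) + 1 = i
        · rw [if_neg (mt hij.1 h1), if_pos (Or.inr h3.symm), if_neg h1, if_neg h2, if_pos h3,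
            show (i : ℕ) - 1 = j by omega]
          ring
        · rw [if_neg (mt hij.1 h1), if_neg (by omega), if_neg h1, if_neg h2, if_neg h3]
          ring
  rw [Finset.sum_congr rfl (fun j _ => key j),
    Fin.sum_univ_eq_sum_range (fun j : ℕ => (if j = i then 2 * heightCoeff n i else 0) -
      (if j = i + 1 then heightCoeff n (i + 1) else 0) -
      (if j + 1 = i then heightCoeff n (i - 1 : ℕ) else 0)) n,
    Finset.sum_sub_distrib, Finset.sum_sub_distrib, Finset.sum_ite_eq', Finset.sum_ite_eq']
  have hi := i.2
  -- the coefficients vanish at `n` and at `-1`, so the two boundary cases need no correction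
  have e2 : (if (i : ℕ) + 1 ∈ Finset.range n then heightCoeff n (i + 1) else 0)
      = heightCoeff n (i + 1) := by
    split_ifs with h
    · rfl
    · have : n = i + 1 := by simp at h; omega
      simp [heightCoeff, this]
  have e3 : ∑ j ∈ Finset.range n, (if j + 1 = (i : ℕ) then heightCoeff n (i - 1 : ℕ) else 0)
      = (i : ℂ) * ((n : ℂ) - i + 1) / 2 := by
    rcases Nat.eq_zero_or_pos (i : ℕ) with h | h
    · rw [h]; simp
    · obtain ⟨k, hk⟩ : ∃ k, (i : ℕ) = k + 1 := ⟨i - 1, by omega⟩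
      rw [hk]
      simp only [add_left_inj, Finset.sum_ite_eq', Finset.mem_range]
      rw [if_pos (by omega)]
      simp only [heightCoeff, Nat.add_sub_cancel]
      push_cast
      ring
  rw [e2, e3, if_pos (by simp)]
  simp only [heightCoeff]
  push_cast
  ring

theorem ht_mul_J (i : Fin n) (t : ℕ) : ht Q * U.J Q i t = U.J Q i t * ht Q := by
  simp only [ht, Finset.sum_mul, Finset.mul_sum, smul_mul_assoc, mul_smul_comm, U.J_mul_J Q i _ t]

theorem ht_mul_Xp (i : Fin n) (t : ℕ) : ht Q * U.Xp Q i t = U.Xp Q i t * ht Q + U.Xp Q i t := by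
  simp only [ht, Finset.sum_mul, Finset.mul_sum, smul_mul_assoc, mul_smul_comm, U.J_mul_Xp,
    smul_add, Finset.sum_add_distrib, zero_add, smul_smul]
  rw [← Finset.sum_smul, sum_heightCoeff_mul_cartan, one_smul]

theorem ht_mul_Xm (i : Fin n) (t : ℕ) : ht Q * U.Xm Q i t = U.Xm Q i t * ht Q - U.Xm Q i t := by
  simp only [ht, Finset.sum_mul, Finset.mul_sum, smul_mul_assoc, mul_smul_comm, U.J_mul_Xm,
    smul_sub, Finset.sum_sub_distrib, zero_add, smul_smul]
  rw [← Finset.sum_smul, sum_heightCoeff_mul_cartan, one_smul]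

end Generators

/-! ### Descending from a space of singular vectors -/

section Descend

variable {n : ℕ} (Q : Fin n → ℂ) {V : Type*} [AddCommGroup V] [Module ℂ V] [Module (U Q) V]

/-- The span of the vectors obtained from `Y` by applying `k` of the operators `X⁻_{i,t}`. -/
def descend (Y : Submodule ℂ V) : ℕ → Submodule ℂ V
  | 0 => Y
  | k + 1 => Submodule.span ℂ {x | ∃ i t, ∃ y ∈ descend Y k, x = U.Xm Q i t • y}

/-- A space of singular vectors of height `μ`: it is killed by all `X⁺_{i,t}`, stable under all
`J_{i,t}`, and the height element acts on it by `μ`. -/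
structure IsSingular (Y : Submodule ℂ V) (μ : ℂ) : Prop where
  Xp_smul : ∀ y ∈ Y, ∀ i t, U.Xp Q i t • y = 0
  J_smul : ∀ y ∈ Y, ∀ i t, U.J Q i t • y ∈ Y
  ht_smul : ∀ y ∈ Y, ht Q • y = μ • y

variable {Q}

theorem iSup_descend_le (Y : Submodule ℂ V) :
    ⨆ k, descend Q Y k ≤ Y ⊔ ⨆ k, descend Q Y (k + 1) := by
  refine iSup_le fun k => ?_
  cases k with
  | zero => exact le_sup_left
  | succ k => exact le_trans (le_iSup (fun k => descend Q Y (k + 1)) k) le_sup_right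

variable [IsScalarTower ℂ (U Q) V] {Y : Submodule ℂ V} {μ : ℂ}

theorem IsSingular.J_smul_mem_descend (hY : IsSingular Q Y μ) (k : ℕ) :
    ∀ x ∈ descend Q Y k, ∀ i t, U.J Q i t • x ∈ descend Q Y k := by
  induction k with
  | zero => exact hY.J_smul
  | succ k ih =>
    intro x hx i t
    induction hx using Submodule.span_induction with
    | mem x h =>
      obtain ⟨j, s, y, hy, rfl⟩ := h
      rw [smul_smul, U.J_mul_Xm, sub_smul, mul_smul, smul_assoc]
      exact Submodule.sub_mem _ (Submodule.subset_span ⟨j, s, _, ih y hy i t, rfl⟩)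
        (Submodule.smul_mem _ _ (Submodule.subset_span ⟨j, t + s, y, hy, rfl⟩))
    | zero => rw [smul_zero]; exact Submodule.zero_mem _
    | add a b _ _ ha hb => rw [smul_add]; exact Submodule.add_mem _ ha hb
    | smul c a _ ha => rw [smul_comm]; exact Submodule.smul_mem _ _ ha

theorem IsSingular.Xp_smul_mem_descend (hY : IsSingular Q Y μ) (k : ℕ) :
    ∀ x ∈ descend Q Y (k + 1), ∀ i t, U.Xp Q i t • x ∈ descend Q Y k := by
  induction k with
  | zero =>
    intro x hx i t
    induction hx using Submodule.span_induction with
    | mem x h =>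
      obtain ⟨j, s, y, hy, rfl⟩ := h
      rw [smul_smul]
      by_cases hij : i = j
      · subst hij
        rw [U.Xp_mul_Xm_same, add_smul, mul_smul, hY.Xp_smul y hy, smul_zero, zero_add, sub_smul,
          smul_assoc]
        exact Submodule.sub_mem _ (hY.J_smul y hy _ _)
          (Submodule.smul_mem _ _ (hY.J_smul y hy _ _))
      · rw [U.Xp_mul_Xm_ne Q hij, mul_smul, hY.Xp_smul y hy, smul_zero]
        exact Submodule.zero_mem _
    | zero => rw [smul_zero]; exact Submodule.zero_mem _
    | add a b _ _ ha hb => rw [smul_add]; exact Submodule.add_mem _ ha hb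
    | smul c a _ ha => rw [smul_comm]; exact Submodule.smul_mem _ _ ha
  | succ k ih =>
    intro x hx i t
    induction hx using Submodule.span_induction with
    | mem x h =>
      obtain ⟨j, s, y, hy, rfl⟩ := h
      rw [smul_smul]
      have h1 : U.Xm Q j s • U.Xp Q i t • y ∈ descend Q Y (k + 1) :=
        Submodule.subset_span ⟨j, s, _, ih y hy i t, rfl⟩
      by_cases hij : i = j
      · subst hij
        rw [U.Xp_mul_Xm_same, add_smul, mul_smul, sub_smul, smul_assoc]
        exact Submodule.add_mem _ h1 (Submodule.sub_mem _ (hY.J_smul_mem_descend _ y hy _ _)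
          (Submodule.smul_mem _ _ (hY.J_smul_mem_descend _ y hy _ _)))
      · rw [U.Xp_mul_Xm_ne Q hij, mul_smul]
        exact h1
    | zero => rw [smul_zero]; exact Submodule.zero_mem _
    | add a b _ _ ha hb => rw [smul_add]; exact Submodule.add_mem _ ha hb
    | smul c a _ ha => rw [smul_comm]; exact Submodule.smul_mem _ _ ha

theorem IsSingular.ht_smul_descend (hY : IsSingular Q Y μ) (k : ℕ) :
    ∀ x ∈ descend Q Y k, ht Q • x = (μ - k) • x := by
  induction k with
  | zero => intro x hx; rw [hY.ht_smul x hx]; simp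
  | succ k ih =>
    intro x hx
    induction hx using Submodule.span_induction with
    | mem x h =>
      obtain ⟨j, s, y, hy, rfl⟩ := h
      rw [smul_smul, ht_mul_Xm, sub_smul, mul_smul, ih y hy,
        smul_comm (U.Xm Q j s) (μ - (k : ℂ)) y]
      generalize U.Xm Q j s • y = z
      push_cast
      module
    | zero => simp
    | add a b _ _ ha hb => rw [smul_add, ha, hb, smul_add]
    | smul c a _ ha => rw [smul_comm, ha, smul_comm]

/-- The submodule generated by a space `Y` of singular vectors is obtained by applying the
operators `X⁻_{i,t}` to `Y`: this needs only the commutation relations, not a PBW theorem. -/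
theorem IsSingular.span_le_iSup_descend (hY : IsSingular Q Y μ) :
    ∀ x ∈ Submodule.span (U Q) (Y : Set V), x ∈ ⨆ k, descend Q Y k := by
  have hle : ∀ k, descend Q Y k ≤ ⨆ k, descend Q Y k := le_iSup _
  intro x hx
  induction hx using Submodule.span_induction with
  | mem x h => exact hle 0 h
  | zero => exact Submodule.zero_mem _
  | add a b _ _ ha hb => exact Submodule.add_mem _ ha hb
  | smul a y _ hy =>
    refine smul_mem_of_stable Q _ ?_ ?_ ?_ a y hy
    · intro i t x hx
      induction hx using Submodule.iSup_induction' with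
      | mem k x h =>
        cases k with
        | zero => rw [hY.Xp_smul x h]; exact Submodule.zero_mem _
        | succ k => exact hle k (hY.Xp_smul_mem_descend k x h i t)
      | zero => rw [smul_zero]; exact Submodule.zero_mem _
      | add a b _ _ ha hb => rw [smul_add]; exact Submodule.add_mem _ ha hb
    · intro i t x hx
      induction hx using Submodule.iSup_induction' with
      | mem k x h => exact hle (k + 1) (Submodule.subset_span ⟨i, t, x, h, rfl⟩)
      | zero => rw [smul_zero]; exact Submodule.zero_mem _
      | add a b _ _ ha hb => rw [smul_add]; exact Submodule.add_mem _ ha hb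
    · intro i t x hx
      induction hx using Submodule.iSup_induction' with
      | mem k x h => exact hle k (hY.J_smul_mem_descend k x h i t)
      | zero => rw [smul_zero]; exact Submodule.zero_mem _
      | add a b _ _ ha hb => rw [smul_add]; exact Submodule.add_mem _ ha hb

theorem aeval_ht_smul {x : V} {ν : ℂ} (hx : ht Q • x = ν • x) (p : ℂ[X]) :
    aeval (ht Q) p • x = p.eval ν • x := by
  induction p using Polynomial.induction_on' with
  | add p q hp hq => rw [map_add, add_smul, hp, hq, eval_add, add_smul]
  | monomial k a =>
    have hk : ht Q ^ k • x = ν ^ k • x := by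
      induction k with
      | zero => simp
      | succ k ih => rw [pow_succ, mul_smul, hx, smul_comm, ih, smul_smul, pow_succ, mul_comm]
    rw [aeval_monomial, ← Algebra.smul_def, smul_assoc, hk, smul_smul, eval_monomial]

/-- A finite sum of height vectors of heights different from `ν` is killed by a polynomial in the
height element that does not vanish at `ν`. -/
theorem exists_aeval_ht_smul_eq_zero {ι : Type*} {D : ι → Submodule ℂ V} {η : ι → ℂ}
    (hD : ∀ k, ∀ x ∈ D k, ht Q • x = η k • x) {ν : ℂ} (hν : ∀ k, ν ≠ η k) :
    ∀ z ∈ ⨆ k, D k, ∃ p : ℂ[X], p.eval ν ≠ 0 ∧ aeval (ht Q) p • z = 0 := by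
  intro z hz
  induction hz using Submodule.iSup_induction' with
  | mem k x h =>
    refine ⟨X - C (η k), by simpa [sub_eq_zero] using hν k, ?_⟩
    rw [aeval_ht_smul (hD k x h)]
    simp
  | zero => exact ⟨1, by simp, by simp⟩
  | add a b _ _ ha hb =>
    obtain ⟨p, hp, hpa⟩ := ha
    obtain ⟨q, hq, hqb⟩ := hb
    refine ⟨p * q, by simp [hp, hq], ?_⟩
    have h1 : aeval (ht Q) (p * q) • a = 0 := by
      rw [mul_comm, map_mul, mul_smul, hpa, smul_zero]
    have h2 : aeval (ht Q) (p * q) • b = 0 := by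
      rw [map_mul, mul_smul, hqb, smul_zero]
    rw [smul_add, h1, h2, add_zero]

theorem IsSingular.exists_aeval_ht_smul_eq_zero (hY : IsSingular Q Y μ) :
    ∀ z ∈ ⨆ k, descend Q Y (k + 1), ∃ p : ℂ[X], p.eval μ ≠ 0 ∧ aeval (ht Q) p • z = 0 :=
  DeformedCurrent.exists_aeval_ht_smul_eq_zero (fun k => hY.ht_smul_descend (k + 1)) (by
    intro k h
    have : ((k + 1 : ℕ) : ℂ) = 0 := by linear_combination h
    exact Nat.cast_ne_zero.2 (Nat.succ_ne_zero k) this)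

/-- The vectors of top height in the submodule generated by a space of singular vectors. -/
theorem IsSingular.mem_of_ht_smul (hY : IsSingular Q Y μ) {x : V}
    (hx : x ∈ Submodule.span (U Q) (Y : Set V)) (h : ht Q • x = μ • x) : x ∈ Y := by
  obtain ⟨y, hy, z, hz, rfl⟩ :=
    Submodule.mem_sup.1 (iSup_descend_le Y (hY.span_le_iSup_descend x hx))
  obtain ⟨p, hp, hpz⟩ := hY.exists_aeval_ht_smul_eq_zero z hz
  have hz' : ht Q • z = μ • z := by
    rw [smul_add, smul_add, hY.ht_smul y hy] at h
    exact add_left_cancel h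
  rw [aeval_ht_smul hz', smul_eq_zero_iff_right hp] at hpz
  rw [hpz, add_zero]
  exact hy

/-- The heights that occur in the submodule generated by a space of singular vectors. -/
theorem IsSingular.exists_eq_sub_of_ht_smul (hY : IsSingular Q Y μ) {x : V} (hx0 : x ≠ 0)
    (hx : x ∈ Submodule.span (U Q) (Y : Set V)) {ν : ℂ} (h : ht Q • x = ν • x) :
    ∃ k : ℕ, ν = μ - k := by
  by_contra! hk
  obtain ⟨p, hp, hpx⟩ := DeformedCurrent.exists_aeval_ht_smul_eq_zero hY.ht_smul_descend hk x
    (hY.span_le_iSup_descend x hx)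
  rw [aeval_ht_smul h, smul_eq_zero_iff_right hp] at hpx
  exact hx0 hpx

end Descend

/-! ### Highest weight modules -/

section HighestWeight

variable {n : ℕ} {Q : Fin n → ℂ} {u : Fin n → ℕ → ℂ}

/-- The height of a vector of weight `u`. -/
def topHeight (u : Fin n → ℕ → ℂ) : ℂ := ∑ j : Fin n, heightCoeff n j * u j 0

/-- A vector killed by all `X⁺_{i,t}`, on which `J_{i,t}` acts by `u i t`. -/
structure IsHWVector (Q : Fin n → ℂ) (u : Fin n → ℕ → ℂ) {M : Type*} [AddCommGroup M]
    [Module (U Q) M] (v : M) : Prop where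
  Xp_smul : ∀ i t, U.Xp Q i t • v = 0
  J_smul : ∀ i t, U.J Q i t • v = algebraMap ℂ (U Q) (u i t) • v

section Module

variable {M : Type*} [AddCommGroup M] [Module ℂ M] [Module (U Q) M] {v : M}

theorem mem_span_coe_span (h : Submodule.span (U Q) {v} = ⊤) (x : M) :
    x ∈ Submodule.span (U Q) (Submodule.span ℂ {v} : Set M) := by
  have : Submodule.span (U Q) {v} ≤ Submodule.span (U Q) (Submodule.span ℂ {v} : Set M) :=
    Submodule.span_mono Submodule.subset_span
  rw [h] at this
  exact this trivial

variable [IsScalarTower ℂ (U Q) M]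

theorem IsHWVector.ht_smul (hv : IsHWVector Q u v) : ht Q • v = topHeight u • v := by
  simp only [ht, topHeight, Finset.sum_smul, smul_assoc, hv.J_smul, algebraMap_smul, mul_smul]

theorem IsHWVector.isSingular (hv : IsHWVector Q u v) :
    IsSingular Q (Submodule.span ℂ {v}) (topHeight u) where
  Xp_smul y hy i t := by
    obtain ⟨c, rfl⟩ := Submodule.mem_span_singleton.1 hy
    rw [smul_comm, hv.Xp_smul, smul_zero]
  J_smul y hy i t := by
    obtain ⟨c, rfl⟩ := Submodule.mem_span_singleton.1 hy
    rw [smul_comm, hv.J_smul, algebraMap_smul]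
    exact Submodule.smul_mem _ _ (Submodule.smul_mem _ _ (Submodule.mem_span_singleton_self v))
  ht_smul y hy := by
    obtain ⟨c, rfl⟩ := Submodule.mem_span_singleton.1 hy
    rw [smul_comm, hv.ht_smul, smul_comm]

/-- In a highest weight module all proper submodules lie in a common proper submodule: a
vector with a nonzero component along the generator generates the whole module, because a
polynomial in the height element projects it to the generator. -/
theorem IsHWVector.sSup_ne_top (hv : IsHWVector Q u v) (h0 : v ≠ 0)
    (h : Submodule.span (U Q) {v} = ⊤) : sSup {N : Submodule (U Q) M | N ≠ ⊤} ≠ ⊤ := by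
  set D : Submodule ℂ M := ⨆ k, descend Q (Submodule.span ℂ {v}) (k + 1) with hD
  have hvD : v ∉ D := by
    intro hvD
    obtain ⟨p, hp, hpv⟩ := hv.isSingular.exists_aeval_ht_smul_eq_zero v hvD
    rw [aeval_ht_smul hv.ht_smul, smul_eq_zero_iff_right hp] at hpv
    exact h0 hpv
  have hND : ∀ N : Submodule (U Q) M, N ≠ ⊤ → ∀ x ∈ N, x ∈ D := by
    intro N hN x hx
    obtain ⟨y, hy, z, hz, rfl⟩ := Submodule.mem_sup.1 (iSup_descend_le _
      (hv.isSingular.span_le_iSup_descend x (mem_span_coe_span h x)))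
    obtain ⟨c, rfl⟩ := Submodule.mem_span_singleton.1 hy
    by_cases hc : c = 0
    · rw [hc, zero_smul, zero_add]; exact hz
    · exfalso
      obtain ⟨p, hp, hpz⟩ := hv.isSingular.exists_aeval_ht_smul_eq_zero z hz
      have h2 := N.smul_mem (aeval (ht Q) p) hx
      rw [smul_add, hpz, add_zero, smul_comm, aeval_ht_smul hv.ht_smul, smul_smul,
        ← algebraMap_smul (U Q)] at h2
      have h3 := N.smul_mem (algebraMap ℂ (U Q) (c * p.eval (topHeight u))⁻¹) h2
      rw [algebraMap_smul, algebraMap_smul, inv_smul_smul₀ (mul_ne_zero hc hp)] at h3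
      apply hN
      rw [eq_top_iff, ← h, Submodule.span_le]
      simpa using h3
  let T : Submodule (U Q) M :=
    { carrier := {x | ∀ a : U Q, a • x ∈ D}
      zero_mem' := by intro a; rw [smul_zero]; exact D.zero_mem
      add_mem' := by intro x y hx hy a; rw [smul_add]; exact D.add_mem (hx a) (hy a)
      smul_mem' := by intro b x hx a; rw [smul_smul]; exact hx _ }
  have hle : sSup {N : Submodule (U Q) M | N ≠ ⊤} ≤ T :=
    sSup_le fun N hN x hx a => hND N hN _ (N.smul_mem a hx)
  intro htop
  rw [htop] at hle
  have : v ∈ T := hle trivial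
  have h1 := this 1
  rw [one_smul] at h1
  exact hvD h1

/-- The highest weight of a highest weight module is an isomorphism invariant. -/
theorem IsHWVector.eq_of_equiv {u' : Fin n → ℕ → ℂ} {M' : Type*} [AddCommGroup M'] [Module ℂ M']
    [Module (U Q) M'] [IsScalarTower ℂ (U Q) M'] {v' : M'} (hv : IsHWVector Q u v) (h0 : v ≠ 0)
    (h : Submodule.span (U Q) {v} = ⊤) (hv' : IsHWVector Q u' v') (h0' : v' ≠ 0)
    (h' : Submodule.span (U Q) {v'} = ⊤) (e : M ≃ₗ[U Q] M') : u = u' := by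
  have key : ht Q • e v = topHeight u • e v := by
    rw [← map_smul, hv.ht_smul, ← algebraMap_smul (U Q), map_smul, algebraMap_smul]
  have key' : ht Q • e.symm v' = topHeight u' • e.symm v' := by
    rw [← map_smul, hv'.ht_smul, ← algebraMap_smul (U Q), map_smul, algebraMap_smul]
  have hev : e v ≠ 0 := by simpa using h0
  obtain ⟨k, hk⟩ := hv'.isSingular.exists_eq_sub_of_ht_smul hev (mem_span_coe_span h' _) key
  obtain ⟨l, hl⟩ := hv.isSingular.exists_eq_sub_of_ht_smul (by simpa using h0')
    (mem_span_coe_span h _) key'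
  have hkl : ((k + l : ℕ) : ℂ) = 0 := by push_cast; linear_combination hk + hl
  have hk0 : k = 0 := by
    have : k + l = 0 := by exact_mod_cast hkl
    omega
  have heq : topHeight u = topHeight u' := by rw [hk, hk0]; simp
  rw [heq] at key
  obtain ⟨c, hc⟩ := Submodule.mem_span_singleton.1
    (hv'.isSingular.mem_of_ht_smul (mem_span_coe_span h' _) key)
  funext i t
  have h1 : U.J Q i t • e v = u i t • e v := by
    rw [← map_smul, hv.J_smul, map_smul, algebraMap_smul]
  have h2 : U.J Q i t • e v = u' i t • e v := by
    rw [← hc, smul_comm, hv'.J_smul, algebraMap_smul, smul_comm]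
  exact smul_left_injective ℂ hev (h1.symm.trans h2)

end Module

/-! ### Verma modules and their simple quotients -/

/-- The canonical generator of the Verma module. -/
def vermaVec (Q : Fin n → ℂ) (u : Fin n → ℕ → ℂ) : Verma Q u := Submodule.Quotient.mk 1

theorem smul_vermaVec (a : U Q) : a • vermaVec Q u = Submodule.Quotient.mk a := by
  rw [vermaVec, ← Submodule.Quotient.mk_smul, smul_eq_mul, mul_one]

theorem isHWVector_vermaVec : IsHWVector Q u (vermaVec Q u) where
  Xp_smul i t := by
    rw [smul_vermaVec, Submodule.Quotient.mk_eq_zero]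
    exact Submodule.subset_span (Or.inl ⟨i, t, rfl⟩)
  J_smul i t := by
    rw [← sub_eq_zero, ← sub_smul, smul_vermaVec, Submodule.Quotient.mk_eq_zero]
    exact Submodule.subset_span (Or.inr ⟨i, t, rfl⟩)

theorem span_vermaVec : Submodule.span (U Q) {vermaVec Q u} = ⊤ := by
  rw [eq_top_iff]
  intro x _
  obtain ⟨a, rfl⟩ := Submodule.Quotient.mk_surjective _ x
  rw [← smul_vermaVec]
  exact Submodule.smul_mem _ _ (Submodule.mem_span_singleton_self _)

theorem exists_verma_hom {M : Type*} [AddCommGroup M] [Module (U Q) M] {v : M}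
    (hv : IsHWVector Q u v) : ∃ f : Verma Q u →ₗ[U Q] M, f (vermaVec Q u) = v := by
  refine ⟨Submodule.liftQ _ (LinearMap.toSpanSingleton (U Q) M v) ?_, ?_⟩
  · rw [vermaIdeal, Submodule.span_le]
    rintro x (⟨i, t, rfl⟩ | ⟨i, t, rfl⟩)
    · simpa using hv.Xp_smul i t
    · simp [sub_smul, hv.J_smul i t]
  · rw [vermaVec, Submodule.liftQ_apply]
    simp

theorem vermaRad_ne_top (h : vermaVec Q u ≠ 0) : vermaRad Q u ≠ ⊤ :=
  isHWVector_vermaVec.sSup_ne_top h span_vermaVec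

theorem le_vermaRad {N : Submodule (U Q) (Verma Q u)} (h : N ≠ ⊤) : N ≤ vermaRad Q u := le_sSup h

theorem isSimpleModule_simple (h : vermaVec Q u ≠ 0) : IsSimpleModule (U Q) (Simple Q u) := by
  rw [isSimpleModule_iff_isCoatom]
  refine ⟨vermaRad_ne_top h, fun N hN => ?_⟩
  by_contra hN'
  exact absurd (le_vermaRad hN') (not_le_of_gt hN)

/-- The canonical generator of the simple quotient of the Verma module. -/
def simpleVec (Q : Fin n → ℂ) (u : Fin n → ℕ → ℂ) : Simple Q u :=
  (vermaRad Q u).mkQ (vermaVec Q u)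

theorem isHWVector_simpleVec : IsHWVector Q u (simpleVec Q u) where
  Xp_smul i t := by
    rw [simpleVec, ← map_smul, isHWVector_vermaVec.Xp_smul, map_zero]
  J_smul i t := by
    rw [simpleVec, ← map_smul, isHWVector_vermaVec.J_smul, map_smul]

theorem span_simpleVec : Submodule.span (U Q) {simpleVec Q u} = ⊤ := by
  rw [simpleVec, ← Set.image_singleton, ← Submodule.map_span, span_vermaVec, Submodule.map_top,
    Submodule.range_mkQ]

theorem simpleVec_ne_zero (h : vermaVec Q u ≠ 0) : simpleVec Q u ≠ 0 := by
  intro h0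
  apply vermaRad_ne_top h
  rw [eq_top_iff, ← span_vermaVec, Submodule.span_le]
  simpa [simpleVec] using h0

theorem vermaVec_ne_zero_of_isHWVector {M : Type*} [AddCommGroup M] [Module (U Q) M] {v : M}
    (hv : IsHWVector Q u v) (h0 : v ≠ 0) : vermaVec Q u ≠ 0 := by
  obtain ⟨f, hf⟩ := exists_verma_hom hv
  rintro h
  rw [h, map_zero] at hf
  exact h0 hf.symm

theorem nonempty_equiv_simple {M : Type*} [AddCommGroup M] [Module (U Q) M]
    [IsSimpleModule (U Q) M] {v : M} (hv : IsHWVector Q u v) (h0 : v ≠ 0) :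
    Nonempty (M ≃ₗ[U Q] Simple Q u) := by
  obtain ⟨f, hf⟩ := exists_verma_hom hv
  have hf0 : f ≠ 0 := by
    rintro rfl
    exact h0 hf.symm
  have hsurj : Function.Surjective f := LinearMap.surjective_of_ne_zero hf0
  have hker : IsCoatom (LinearMap.ker f) := by
    rw [← isSimpleModule_iff_isCoatom]
    exact IsSimpleModule.congr (f.quotKerEquivOfSurjective hsurj)
  have hle : LinearMap.ker f = vermaRad Q u :=
    (hker.le_iff_eq (vermaRad_ne_top (vermaVec_ne_zero_of_isHWVector hv h0))).1
      (le_vermaRad hker.1) |>.symm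
  exact ⟨(f.quotKerEquivOfSurjective hsurj).symm.trans (Submodule.quotEquivOfEq _ _ hle)⟩

theorem finiteDimensional_quotient_of_ker_le {A : Type*} [Ring A] [Algebra ℂ A] {X M : Type*}
    [AddCommGroup X] [Module ℂ X] [Module A X] [IsScalarTower ℂ A X] [AddCommGroup M] [Module ℂ M]
    [Module A M] [IsScalarTower ℂ A M] [FiniteDimensional ℂ M] (f : X →ₗ[A] M)
    (N : Submodule A X) (h : LinearMap.ker f ≤ N) : FiniteDimensional ℂ (X ⧸ N) := by
  have : FiniteDimensional ℂ (X ⧸ LinearMap.ker (f.restrictScalars ℂ)) :=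
    (LinearMap.quotKerEquivRange (f.restrictScalars ℂ)).symm.finiteDimensional
  have hle : LinearMap.ker (f.restrictScalars ℂ) ≤ LinearMap.ker (N.mkQ.restrictScalars ℂ) := by
    intro x hx
    have hx' : x ∈ LinearMap.ker f := hx
    simpa using h hx'
  refine Module.Finite.of_surjective (Submodule.liftQ _ (N.mkQ.restrictScalars ℂ) hle) ?_
  intro y
  obtain ⟨x, rfl⟩ := N.mkQ_surjective y
  exact ⟨Submodule.Quotient.mk x, rfl⟩

/-- `L(u)` is a subquotient of every module that has a nonzero highest weight vector of weight
`u`. -/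
theorem finiteDimensional_simple {M : Type*} [AddCommGroup M] [Module ℂ M] [Module (U Q) M]
    [IsScalarTower ℂ (U Q) M] [FiniteDimensional ℂ M] {v : M} (hv : IsHWVector Q u v)
    (h0 : v ≠ 0) : FiniteDimensional ℂ (Simple Q u) := by
  obtain ⟨f, hf⟩ := exists_verma_hom hv
  have hker : LinearMap.ker f ≠ ⊤ := by
    intro h
    rw [LinearMap.ker_eq_top] at h
    rw [h] at hf
    exact h0 hf.symm
  exact finiteDimensional_quotient_of_ker_le f _ (le_vermaRad hker)

end HighestWeight

/-! ### Fermionic second quantization -/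

section Fock

variable (ι : Type*)

/-- The fermionic Fock space of `ℂ^ι`, that is, its exterior algebra. -/
abbrev Fock : Type _ := ExteriorAlgebra ℂ (ι → ℂ)

instance [Finite ι] : FiniteDimensional ℂ (Fock ι) := by
  have hbot : ∀ k, Module.finrank ℂ (ι → ℂ) < k → (⋀[ℂ]^k (ι → ℂ)) = ⊥ := by
    intro k hk
    apply Submodule.finrank_eq_zero.1
    rw [exteriorPower.finrank_eq, Nat.choose_eq_zero_of_lt hk]
  have htop : (⨆ k ∈ Finset.range (Module.finrank ℂ (ι → ℂ) + 1), ⋀[ℂ]^k (ι → ℂ)) =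
      (⊤ : Submodule ℂ (Fock ι)) := by
    rw [eq_top_iff, ← (DirectSum.Decomposition.isInternal
      (fun k => ⋀[ℂ]^k (ι → ℂ))).submodule_iSup_eq_top]
    refine iSup_le fun k => ?_
    by_cases hk : k < Module.finrank ℂ (ι → ℂ) + 1
    · exact le_iSup₂_of_le k (Finset.mem_range.2 hk) le_rfl
    · rw [hbot k (by omega)]
      exact bot_le
  refine ⟨?_⟩
  rw [← htop]
  exact Submodule.fg_biSup _ _ fun k _ => Module.Finite.iff_fg.1 inferInstance

variable {ι}

/-- The annihilation operator: contraction with the `p`-th coordinate. -/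
def annihilation (p : ι) : Module.End ℂ (Fock ι) :=
  CliffordAlgebra.contractLeft (LinearMap.proj p)

theorem annihilation_mul_annihilation (p q : ι) :
    annihilation p * annihilation q = -(annihilation q * annihilation p) := by
  refine LinearMap.ext fun x => ?_
  exact CliffordAlgebra.contractLeft_comm (Q := (0 : QuadraticForm ℂ (ι → ℂ))) _ _ x

variable [DecidableEq ι]

/-- The creation operator: exterior multiplication by the basis vector `e_p`. -/
def creation (p : ι) : Module.End ℂ (Fock ι) :=
  LinearMap.mulLeft ℂ (ExteriorAlgebra.ι ℂ (Pi.single p 1))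

theorem annihilation_mul_creation (p q : ι) :
    annihilation p * creation q = (if p = q then 1 else 0) - creation q * annihilation p := by
  refine LinearMap.ext fun x => ?_
  have h := CliffordAlgebra.contractLeft_ι_mul (Q := (0 : QuadraticForm ℂ (ι → ℂ)))
    (d := LinearMap.proj p) (Pi.single q 1) x
  simp only [LinearMap.proj_apply, Pi.single_apply] at h
  refine Eq.trans h ?_
  split_ifs
  · rw [one_smul]; rfl
  · rw [zero_smul]; rfl

theorem creation_mul_creation (p q : ι) :
    creation p * creation q = -(creation q * creation p) := by
  refine LinearMap.ext fun x => ?_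
  have h := ExteriorAlgebra.ι_add_mul_swap (R := ℂ) (Pi.single p 1 : ι → ℂ) (Pi.single q 1)
  simp only [creation, Module.End.mul_apply, LinearMap.neg_apply, LinearMap.mulLeft_apply,
    ← mul_assoc]
  rw [eq_neg_of_add_eq_zero_left h, neg_mul]

theorem creation_mul_self (p : ι) : creation p * creation p = 0 := by
  refine LinearMap.ext fun x => ?_
  simp [creation, ← mul_assoc]

/-- The Fock vector `⋀_{p ∈ S} e_p`, characterised by the occupied states. -/
theorem exists_occupied (S : Finset ι) : ∃ v : Fock ι, v ≠ 0 ∧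
    (∀ p ∈ S, creation p v = 0) ∧ (∀ p ∉ S, annihilation p v = 0) := by
  induction S using Finset.induction_on with
  | empty =>
    refine ⟨1, one_ne_zero, by simp, fun p _ => ?_⟩
    exact CliffordAlgebra.contractLeft_one (Q := (0 : QuadraticForm ℂ (ι → ℂ)))
      (d := LinearMap.proj p)
  | insert p S hp ih =>
    obtain ⟨v, hv0, hc, ha⟩ := ih
    refine ⟨creation p v, ?_, ?_, ?_⟩
    · intro h0
      have h := congrArg (fun f => f v) (annihilation_mul_creation p p)
      simp only [Module.End.mul_apply, if_true, LinearMap.sub_apply, Module.End.one_apply, ha p hp,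
        map_zero, sub_zero, h0] at h
      exact hv0 h.symm
    · intro q hq
      rcases Finset.mem_insert.1 hq with rfl | hq
      · rw [← Module.End.mul_apply, creation_mul_self, LinearMap.zero_apply]
      · rw [← Module.End.mul_apply, creation_mul_creation, LinearMap.neg_apply,
          Module.End.mul_apply, hc q hq, map_zero, neg_zero]
    · intro q hq
      rw [Finset.mem_insert, not_or] at hq
      rw [← Module.End.mul_apply, annihilation_mul_creation, if_neg hq.1, zero_sub,
        LinearMap.neg_apply, Module.End.mul_apply, ha q hq.2, map_zero, neg_zero]

variable [Fintype ι]

/-- The second quantization of a matrix: its extension to a derivation of the exterior algebra. -/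
def secondQuant : Matrix ι ι ℂ →ₗ[ℂ] Module.End ℂ (Fock ι) where
  toFun A := ∑ p, ∑ q, A p q • (creation p * annihilation q)
  map_add' A B := by simp only [Matrix.add_apply, add_smul, Finset.sum_add_distrib]
  map_smul' c A := by
    simp only [Matrix.smul_apply, smul_assoc, Finset.smul_sum, RingHom.id_apply]

theorem secondQuant_apply (A : Matrix ι ι ℂ) :
    secondQuant A = ∑ p, ∑ q, A p q • (creation p * annihilation q) := rfl

theorem secondQuant_single (p q : ι) (c : ℂ) :
    secondQuant (Matrix.single p q c) = c • (creation p * annihilation q) := by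
  rw [secondQuant_apply, Finset.sum_eq_single p, Finset.sum_eq_single q]
  · simp
  · intro b _ hb
    simp [Matrix.single_apply_of_ne, hb.symm]
  · simp
  · intro b _ hb
    refine Finset.sum_eq_zero fun r _ => ?_
    rw [Matrix.single_apply_of_row_ne hb.symm, zero_smul]
  · simp

theorem secondQuant_lie_single (p q r s : ι) (a b : ℂ) :
    secondQuant ⁅Matrix.single p q a, Matrix.single r s b⁆ =
      ⁅secondQuant (Matrix.single p q a), secondQuant (Matrix.single r s b)⁆ := by
  have key : ∀ p q r s : ι, creation p * annihilation q * (creation r * annihilation s) =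
      (if q = r then creation p * annihilation s else 0) +
        creation p * creation r * (annihilation s * annihilation q) := by
    intro p q r s
    rw [mul_assoc, ← mul_assoc (annihilation q), annihilation_mul_creation, sub_mul, mul_sub,
      mul_assoc (creation r), annihilation_mul_annihilation q s]
    split_ifs <;> simp [mul_assoc]
  have hsingle : ∀ (p q r s : ι) (a b : ℂ),
      secondQuant (Matrix.single p q a * Matrix.single r s b) =
        (a * b) • (if q = r then creation p * annihilation s else 0) := by
    intro p q r s a b
    split_ifs with h
    · subst h
      rw [Matrix.single_mul_single_same, secondQuant_single]
    · rw [Matrix.single_mul_single_of_ne _ _ _ _ h, map_zero, smul_zero]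
  rw [LieRing.of_associative_ring_bracket, LieRing.of_associative_ring_bracket, map_sub, hsingle,
    hsingle, secondQuant_single, secondQuant_single, smul_mul_smul_comm, smul_mul_smul_comm,
    key p q r s, key r s p q, creation_mul_creation r p, annihilation_mul_annihilation q s,
    neg_mul_neg, mul_comm b a]
  module

/-- Second quantization is a homomorphism of Lie algebras. -/
def secondQuantLie : Matrix ι ι ℂ →ₗ⁅ℂ⁆ Module.End ℂ (Fock ι) :=
  { secondQuant with
    map_lie' := by
      intro A B
      change secondQuant ⁅A, B⁆ = ⁅secondQuant A, secondQuant B⁆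
      induction A using Matrix.induction_on' with
      | h_zero => simp
      | h_add A A' h h' => rw [add_lie, map_add, h, h', map_add, add_lie]
      | h_std_basis p q a =>
        induction B using Matrix.induction_on' with
        | h_zero => simp
        | h_add B B' h h' => rw [lie_add, map_add, h, h', map_add, lie_add]
        | h_std_basis r s b => exact secondQuant_lie_single p q r s a b }

/-- The off-diagonal part of `A` kills the vector with occupied states `S` if it moves no particle
from a state of `S` to a state outside `S`. -/
theorem secondQuant_occupied {S : Finset ι} {v : Fock ι} (hc : ∀ p ∈ S, creation p v = 0)
    (ha : ∀ p ∉ S, annihilation p v = 0) {A : Matrix ι ι ℂ}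
    (hA : ∀ p q, A p q ≠ 0 → p = q ∨ (q ∈ S → p ∈ S)) :
    secondQuant A v = (∑ p ∈ S, A p p) • v := by
  have key : ∀ p q, A p q • creation p (annihilation q v) =
      if p = q then (if p ∈ S then A p p • v else 0) else 0 := by
    intro p q
    by_cases hq : q ∈ S
    · have hca : creation p (annihilation q v) = (if p = q then v else 0) -
          annihilation q (creation p v) := by
        have h := congrArg (fun f => f v) (annihilation_mul_creation q p)
        simp only [Module.End.mul_apply, LinearMap.sub_apply] at h
        rw [h]
        simp only [eq_comm (a := q)]
        split_ifs <;> simp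
      by_cases hpq : p = q
      · subst hpq
        rw [hca, hc p hq]
        simp [hq]
      · rw [if_neg hpq]
        by_cases h0 : A p q = 0
        · rw [h0, zero_smul]
        · rw [hca, hc p (((hA p q h0).resolve_left hpq) hq), if_neg hpq]
          simp
    · rw [ha q hq, map_zero, smul_zero]
      split_ifs with h1 h2
      · exact absurd (h1 ▸ h2) hq
      · rfl
      · rfl
  simp only [secondQuant_apply, LinearMap.sum_apply, LinearMap.smul_apply, Module.End.mul_apply,
    key, Finset.sum_ite_eq, Finset.mem_univ, if_true]
  rw [← Finset.sum_filter, Finset.sum_smul, Finset.filter_mem_eq_inter, Finset.univ_inter]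

end Fock

/-! ### The evaluation representations of the vector representation -/

section Evaluation

open Matrix

variable {n : ℕ}

/-- The Chevalley generator `e_i`. -/
def chevE (i : Fin n) : Matrix (Fin (n + 1)) (Fin (n + 1)) ℂ := single i.castSucc i.succ 1

/-- The Chevalley generator `f_i`. -/
def chevF (i : Fin n) : Matrix (Fin (n + 1)) (Fin (n + 1)) ℂ := single i.succ i.castSucc 1

/-- The simple coroot `h_i`. -/
def chevH (i : Fin n) : Matrix (Fin (n + 1)) (Fin (n + 1)) ℂ :=
  diagonal fun k => (if k = i.castSucc then 1 else 0) - (if k = i.succ then 1 else 0)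

theorem diagonal_lie_single (d : Fin (n + 1) → ℂ) (a b : Fin (n + 1)) :
    ⁅diagonal d, single a b (1 : ℂ)⁆ = (d a - d b) • single a b (1 : ℂ) := by
  ext x y
  rw [LieRing.of_associative_ring_bracket, Matrix.sub_apply, diagonal_mul, mul_diagonal, Matrix.smul_apply,
    single_apply]
  split_ifs with h
  · rw [h.1, h.2]; simp
  · simp

theorem castSucc_ne_succ_self (i : Fin n) : i.castSucc ≠ i.succ := by
  simp [Fin.ext_iff]

/-- The Cartan matrix entry as the difference of the diagonal entries of `h_j` at the two indices
of the matrix unit `e_i`. -/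
theorem cartan_eq (j i : Fin n) : cartan j i =
    ((if i.castSucc = j.castSucc then 1 else 0) - (if i.castSucc = j.succ then 1 else 0)) -
    ((if i.succ = j.castSucc then 1 else 0) - (if i.succ = j.succ then (1 : ℂ) else 0)) := by
  unfold cartan Adj
  simp only [Fin.ext_iff, Fin.val_castSucc, Fin.val_succ]
  by_cases h1 : (j : ℕ) = i
  · rw [if_pos h1, if_pos h1.symm, if_neg (by omega), if_neg (by omega), if_pos (by omega)]
    norm_num
  · rw [if_neg h1, if_neg (Ne.symm h1), if_neg (show ¬ (i : ℕ) + 1 = j + 1 by omega)]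
    by_cases h2 : (j : ℕ) = i + 1
    · rw [if_pos (Or.inl h2), if_neg (by omega), if_pos (by omega)]
      norm_num
    · by_cases h3 : (i : ℕ) = j + 1
      · rw [if_pos (Or.inr h3), if_pos h3, if_neg (by omega)]
        norm_num
      · rw [if_neg (by omega), if_neg h3, if_neg (by omega)]
        norm_num

theorem chevH_lie_chevH (i j : Fin n) : ⁅chevH i, chevH j⁆ = 0 := by
  rw [LieRing.of_associative_ring_bracket, chevH, chevH, diagonal_mul_diagonal,
    diagonal_mul_diagonal, sub_eq_zero]
  simp only [mul_comm]

theorem chevH_lie_chevE (i j : Fin n) : ⁅chevH j, chevE i⁆ = cartan j i • chevE i := by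
  rw [chevH, chevE, diagonal_lie_single, cartan_eq]

theorem chevH_lie_chevF (i j : Fin n) : ⁅chevH j, chevF i⁆ = -(cartan j i • chevF i) := by
  rw [chevH, chevF, diagonal_lie_single, cartan_eq, ← neg_smul]
  congr 1
  ring

theorem chevE_lie_chevF_same (i : Fin n) : ⁅chevE i, chevF i⁆ = chevH i := by
  rw [LieRing.of_associative_ring_bracket, chevE, chevF, single_mul_single_same,
    single_mul_single_same, chevH]
  ext x y
  rw [Matrix.sub_apply, single_apply, single_apply, diagonal_apply]
  by_cases hxy : x = y
  · subst hxy
    simp [eq_comm]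
  · rw [if_neg (by rintro ⟨rfl, rfl⟩; exact hxy rfl),
      if_neg (by rintro ⟨rfl, rfl⟩; exact hxy rfl), if_neg hxy, sub_zero]

theorem chevE_lie_chevF_ne {i j : Fin n} (h : i ≠ j) : ⁅chevE i, chevF j⁆ = 0 := by
  rw [LieRing.of_associative_ring_bracket, chevE, chevF,
    single_mul_single_of_ne _ _ _ _ (by simpa using h),
    single_mul_single_of_ne _ _ _ _ (by simpa using h.symm), sub_zero]

theorem chevE_mul_chevE_of_not_adj {i j : Fin n} (h : ¬ Adj i j) : chevE i * chevE j = 0 := by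
  rw [chevE, chevE, single_mul_single_of_ne]
  intro h'
  rw [Fin.ext_iff, Fin.val_succ, Fin.val_castSucc] at h'
  exact h (Or.inl h'.symm)

theorem chevF_mul_chevF_of_not_adj {i j : Fin n} (h : ¬ Adj i j) : chevF i * chevF j = 0 := by
  rw [chevF, chevF, single_mul_single_of_ne]
  intro h'
  rw [Fin.ext_iff, Fin.val_succ, Fin.val_castSucc] at h'
  exact h (Or.inr h')

theorem Adj.symm {i j : Fin n} (h : Adj i j) : Adj j i := Or.symm h

theorem not_adj_self (i : Fin n) : ¬ Adj i i := by
  unfold Adj; omega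

theorem chevE_lie_chevE {i j : Fin n} (h : ¬ Adj i j) : ⁅chevE i, chevE j⁆ = 0 := by
  rw [LieRing.of_associative_ring_bracket, chevE_mul_chevE_of_not_adj h,
    chevE_mul_chevE_of_not_adj (mt Adj.symm h), sub_zero]

theorem chevF_lie_chevF {i j : Fin n} (h : ¬ Adj i j) : ⁅chevF i, chevF j⁆ = 0 := by
  rw [LieRing.of_associative_ring_bracket, chevF_mul_chevF_of_not_adj h,
    chevF_mul_chevF_of_not_adj (mt Adj.symm h), sub_zero]

theorem chevE_serre {i j : Fin n} (h : Adj i j) : ⁅chevE i, ⁅chevE i, chevE j⁆⁆ = 0 := by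
  have h0 : chevE i * chevE i = 0 := chevE_mul_chevE_of_not_adj (not_adj_self i)
  have h1 : chevE i * chevE j * chevE i = 0 := by
    rw [chevE, chevE]
    rcases h with h | h
    · rw [mul_assoc, single_mul_single_of_ne _ _ _ _ (show j.succ ≠ i.castSucc by simp [Fin.ext_iff]; omega), mul_zero]
    · rw [single_mul_single_of_ne, zero_mul]
      simp [Fin.ext_iff]; omega
  simp only [LieRing.of_associative_ring_bracket, mul_sub, sub_mul]
  rw [← mul_assoc, h0, ← mul_assoc, h1, mul_assoc (chevE j), h0]
  simp

theorem chevF_serre {i j : Fin n} (h : Adj i j) : ⁅chevF i, ⁅chevF i, chevF j⁆⁆ = 0 := by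
  have h0 : chevF i * chevF i = 0 := chevF_mul_chevF_of_not_adj (not_adj_self i)
  have h1 : chevF i * chevF j * chevF i = 0 := by
    rw [chevF, chevF]
    rcases h with h | h
    · rw [single_mul_single_of_ne, zero_mul]
      simp [Fin.ext_iff]; omega
    · rw [mul_assoc, single_mul_single_of_ne _ _ _ _ (show j.castSucc ≠ i.succ by simp [Fin.ext_iff]; omega), mul_zero]
  simp only [LieRing.of_associative_ring_bracket, mul_sub, sub_mul]
  rw [← mul_assoc, h0, ← mul_assoc, h1, mul_assoc (chevF j), h0]
  simp

variable (Q : Fin n → ℂ)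

/-- The vector representation evaluated at `γ`: the algebra maps to `sl_{n+1}[x]` by
`X⁺_{i,t} ↦ x^t e_i`, `X⁻_{i,t} ↦ (1 - Q_i x) x^t f_i`, `J_{i,t} ↦ x^t h_i`. -/
def evalVec (γ : ℂ) : Free n →ₗ⁅ℂ⁆ Matrix (Fin (n + 1)) (Fin (n + 1)) ℂ :=
  FreeLieAlgebra.lift ℂ fun
    | Gen.Xp i t => γ ^ t • chevE i
    | Gen.Xm i t => ((1 - Q i * γ) * γ ^ t) • chevF i
    | Gen.J i t => γ ^ t • chevH i

theorem evalVec_Xp (γ : ℂ) (i : Fin n) (t : ℕ) : evalVec Q γ (Free.Xp i t) = γ ^ t • chevE i := by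
  rw [evalVec, Free.Xp, FreeLieAlgebra.lift_of_apply]

theorem evalVec_Xm (γ : ℂ) (i : Fin n) (t : ℕ) :
    evalVec Q γ (Free.Xm i t) = ((1 - Q i * γ) * γ ^ t) • chevF i := by
  rw [evalVec, Free.Xm, FreeLieAlgebra.lift_of_apply]

theorem evalVec_J (γ : ℂ) (i : Fin n) (t : ℕ) : evalVec Q γ (Free.J i t) = γ ^ t • chevH i := by
  rw [evalVec, Free.J, FreeLieAlgebra.lift_of_apply]

theorem evalVec_rel (γ : ℂ) {a b : Free n} (h : Rel Q a b) : evalVec Q γ a = evalVec Q γ b := by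
  cases h <;>
    simp only [LieHom.map_lie, map_zero, map_smul, map_neg, map_sub, evalVec_Xp, evalVec_Xm,
      evalVec_J, smul_lie, lie_smul]
  case L1 => rw [chevH_lie_chevH]; simp
  case L2p => rw [chevH_lie_chevE, pow_add]; module
  case L2m => rw [chevH_lie_chevF, pow_add]; module
  case L3_same => rw [chevE_lie_chevF_same, pow_succ, pow_add]; module
  case L3_ne h => rw [chevE_lie_chevF_ne h]; simp
  case L4p h => rw [chevE_lie_chevE h]; simp
  case L4m h => rw [chevF_lie_chevF h]; simp
  case L5p => rw [pow_succ, pow_succ]; module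
  case L5m => rw [pow_succ, pow_succ]; module
  case L6p h => rw [chevE_serre h]; simp
  case L6m h => rw [chevF_serre h]; simp

/-- The character `X^±_{i,t} ↦ 0`, `J_{i,t} ↦ Q_i^{-t} β_i`. -/
def charHom (β : Fin n → ℂ) : Free n →ₗ⁅ℂ⁆ ℂ :=
  FreeLieAlgebra.lift ℂ fun
    | Gen.Xp _ _ => 0
    | Gen.Xm _ _ => 0
    | Gen.J i t => (Q i ^ t)⁻¹ * β i

theorem charHom_lie (β : Fin n → ℂ) (x y : Free n) : charHom Q β ⁅x, y⁆ = 0 := by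
  rw [LieHom.map_lie, LieRing.of_associative_ring_bracket, mul_comm, sub_self]

theorem charHom_Xp (β : Fin n → ℂ) (i : Fin n) (t : ℕ) : charHom Q β (Free.Xp i t) = 0 := by
  rw [charHom, Free.Xp, FreeLieAlgebra.lift_of_apply]

theorem charHom_Xm (β : Fin n → ℂ) (i : Fin n) (t : ℕ) : charHom Q β (Free.Xm i t) = 0 := by
  rw [charHom, Free.Xm, FreeLieAlgebra.lift_of_apply]

theorem charHom_J (β : Fin n → ℂ) (i : Fin n) (t : ℕ) :
    charHom Q β (Free.J i t) = (Q i ^ t)⁻¹ * β i := by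
  rw [charHom, Free.J, FreeLieAlgebra.lift_of_apply]

theorem charHom_rel {β : Fin n → ℂ} (hβ : ∀ i, Q i = 0 → β i = 0) {a b : Free n} (h : Rel Q a b) :
    charHom Q β a = charHom Q β b := by
  cases h <;>
    simp only [charHom_lie, map_zero, map_smul, map_neg, map_sub, charHom_Xp, charHom_Xm,
      charHom_J, smul_zero, neg_zero]
  case L3_same i s t =>
    rcases eq_or_ne (Q i) 0 with h0 | h0
    · simp [hβ i h0]
    · rw [pow_succ, smul_eq_mul]
      field_simp
      simp

variable {R : Type*} [Fintype R] [DecidableEq R]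

/-- The representation on the Fock space of `⊕_r ℂ^{n+1}(γ_r)`, the sum of the vector
representations evaluated at the points `γ_r`, twisted by the character given by `β`. -/
def fockRep (γ : R → ℂ) (β : Fin n → ℂ) : Free n →ₗ⁅ℂ⁆ Module.End ℂ (Fock (Fin (n + 1) × R)) where
  toFun x := secondQuant (blockDiagonal fun r => evalVec Q (γ r) x) +
    algebraMap ℂ _ (charHom Q β x)
  map_add' x y := by
    rw [map_add (charHom Q β), map_add (algebraMap ℂ _),
      show (fun r => evalVec Q (γ r) (x + y)) =
        (fun r => evalVec Q (γ r) x) + (fun r => evalVec Q (γ r) y) from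
        funext fun r => map_add (evalVec Q (γ r)) x y, blockDiagonal_add, map_add]
    abel
  map_smul' c x := by
    rw [map_smul (charHom Q β), smul_eq_mul, map_mul, ← Algebra.smul_def,
      show (fun r => evalVec Q (γ r) (c • x)) = c • (fun r => evalVec Q (γ r) x) from
        funext fun r => map_smul (evalVec Q (γ r)) c x, blockDiagonal_smul, map_smul,
      RingHom.id_apply, smul_add]
  map_lie' := by
    intro x y
    have h1 : (fun r => evalVec Q (γ r) ⁅x, y⁆) =
        (fun r => evalVec Q (γ r) x) * (fun r => evalVec Q (γ r) y) -
        (fun r => evalVec Q (γ r) y) * (fun r => evalVec Q (γ r) x) :=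
      funext fun r => LieHom.map_lie (evalVec Q (γ r)) x y
    have h2 := LieHom.map_lie (secondQuantLie (ι := Fin (n + 1) × R))
      (blockDiagonal fun r => evalVec Q (γ r) x) (blockDiagonal fun r => evalVec Q (γ r) y)
    rw [charHom_lie, map_zero, add_zero, h1, blockDiagonal_sub]
    have h3 : ∀ M N : R → Matrix (Fin (n + 1)) (Fin (n + 1)) ℂ, blockDiagonal (M * N) =
        blockDiagonal M * blockDiagonal N := fun M N => blockDiagonal_mul M N
    rw [h3, h3]
    refine Eq.trans h2 ?_
    rw [LieRing.of_associative_ring_bracket, LieRing.of_associative_ring_bracket]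
    have hc := Algebra.commutes (R := ℂ) (A := Module.End ℂ (Fock (Fin (n + 1) × R)))
    rw [mul_add, add_mul, add_mul, mul_add, add_mul, add_mul, hc _ (secondQuant _),
      hc _ (secondQuant _), hc _ (algebraMap ℂ _ _)]
    change secondQuant _ * secondQuant _ - secondQuant _ * secondQuant _ = _
    abel

theorem fockRep_apply (γ : R → ℂ) (β : Fin n → ℂ) (x : Free n) :
    fockRep Q γ β x = secondQuant (blockDiagonal fun r => evalVec Q (γ r) x) +
    algebraMap ℂ _ (charHom Q β x) := rfl

theorem fockRep_rel (γ : R → ℂ) {β : Fin n → ℂ} (hβ : ∀ i, Q i = 0 → β i = 0) {a b : Free n}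
    (h : Rel Q a b) : fockRep Q γ β a = fockRep Q γ β b := by
  rw [fockRep_apply, fockRep_apply, charHom_rel Q hβ h]
  simp only [evalVec_rel Q _ h]

end Evaluation

/-! ### Highest weight vectors in Fock spaces -/

section FockHighestWeight

open Matrix

variable {n : ℕ} {Q : Fin n → ℂ}

theorem powerSum_zero (φ : ℂ[X]) : powerSum φ 0 = φ.natDegree := by
  simp [powerSum, (IsAlgClosed.splits φ).natDegree_eq_card_roots]

/-- The three cases of the definition of the weight agree with a single formula, because `β_i = 0`
when `Q_i = 0`. -/
theorem weight_eq (p : Param Q) (i : Fin n) (t : ℕ) :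
    weight Q p i t = powerSum (p i).1 t + ((Q i) ^ t)⁻¹ * ((p i).2 : ℂ) := by
  unfold weight
  split_ifs with h1 h2
  · rw [h1, powerSum_zero]; simp
  · rw [(p i).2.2 h2, mul_zero, add_zero]
  · rfl

section

variable {R : Type*} [Fintype R] [DecidableEq R] (c : R → Fin n) (γ : R → ℂ) (β : Fin n → ℂ)

/-- The states occupied in the highest weight vector: in the copy of the vector representation with
index `r`, the first `c r + 1` basis vectors, whose wedge product spans the highest weight line of
the fundamental representation of index `c r`. -/
def occupied : Finset (Fin (n + 1) × R) :=
  Finset.univ.filter fun x => x.1 ≤ (c x.2).castSucc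

theorem sum_occupied (i : Fin n) (t : ℕ) :
    ∑ x ∈ occupied c, blockDiagonal (fun r => evalVec Q (γ r) (Free.J i t)) x x =
      ∑ r, if c r = i then γ r ^ t else 0 := by
  rw [occupied, Finset.sum_filter, Fintype.sum_prod_type, Finset.sum_comm]
  refine Finset.sum_congr rfl fun r _ => ?_
  have key : ∀ k : Fin (n + 1), (if k ≤ (c r).castSucc then
      blockDiagonal (fun r => evalVec Q (γ r) (Free.J i t)) (k, r) (k, r) else 0) =
      (if k = i.castSucc then (if i.castSucc ≤ (c r).castSucc then γ r ^ t else 0) else 0) -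
      (if k = i.succ then (if i.succ ≤ (c r).castSucc then γ r ^ t else 0) else 0) := by
    intro k
    rw [blockDiagonal_apply, if_pos rfl, evalVec_J, Matrix.smul_apply, chevH, diagonal_apply_eq,
      smul_eq_mul]
    by_cases h1 : k = i.castSucc
    · subst h1
      rw [if_pos rfl, if_pos rfl, if_neg (castSucc_ne_succ_self i),
        if_neg (castSucc_ne_succ_self i), sub_zero, sub_zero, mul_one]
    · by_cases h2 : k = i.succ
      · subst h2
        rw [if_neg h1, if_neg h1, if_pos rfl, if_pos rfl]
        split_ifs <;> simp
      · simp [h1, h2]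
  dsimp only
  rw [Finset.sum_congr rfl (fun k _ => key k), Finset.sum_sub_distrib, Finset.sum_ite_eq',
    Finset.sum_ite_eq', if_pos (Finset.mem_univ _), if_pos (Finset.mem_univ _)]
  simp only [Fin.le_def, Fin.ext_iff, Fin.val_castSucc, Fin.val_succ]
  by_cases h1 : (c r : ℕ) = i
  · rw [if_pos (by omega), if_neg (by omega), if_pos h1, sub_zero]
  · by_cases h2 : (i : ℕ) ≤ c r
    · rw [if_pos h2, if_pos (by omega), if_neg h1, sub_self]
    · rw [if_neg h2, if_neg (by omega), if_neg h1, sub_zero]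

/-- The wedge product of the occupied states is a highest weight vector. -/
theorem exists_fockRep_highestWeight : ∃ v : Fock (Fin (n + 1) × R), v ≠ 0 ∧
    (∀ i t, fockRep Q γ β (Free.Xp i t) v = 0) ∧
    (∀ i t, fockRep Q γ β (Free.J i t) v =
      ((∑ r, if c r = i then γ r ^ t else 0) + (Q i ^ t)⁻¹ * β i) • v) := by
  obtain ⟨v, hv0, hc, ha⟩ := exists_occupied (occupied c)
  refine ⟨v, hv0, fun i t => ?_, fun i t => ?_⟩
  · have hA : ∀ x y : Fin (n + 1) × R,
        blockDiagonal (fun r => evalVec Q (γ r) (Free.Xp i t)) x y ≠ 0 →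
        x.1 = i.castSucc ∧ y.1 = i.succ ∧ x.2 = y.2 := by
      intro x y hxy
      rw [blockDiagonal_apply] at hxy
      split_ifs at hxy with h
      · rw [evalVec_Xp, Matrix.smul_apply, chevE, single_apply] at hxy
        split_ifs at hxy with h'
        · exact ⟨h'.1.symm, h'.2.symm, h⟩
        · simp at hxy
      · exact absurd rfl hxy
    rw [fockRep_apply, LinearMap.add_apply, secondQuant_occupied hc ha, charHom_Xp, map_zero,
      LinearMap.zero_apply, add_zero, Finset.sum_eq_zero, zero_smul]
    · intro x _
      by_contra h
      have := hA x x h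
      exact castSucc_ne_succ_self i (this.1.symm.trans this.2.1)
    · intro x y hxy
      obtain ⟨h1, h2, h3⟩ := hA x y hxy
      refine Or.inr fun hy => ?_
      simp only [occupied, Finset.mem_filter, Finset.mem_univ, true_and] at hy ⊢
      rw [h1, h3]
      rw [h2] at hy
      exact le_trans (Fin.castSucc_lt_succ).le hy
  · rw [fockRep_apply, LinearMap.add_apply, secondQuant_occupied hc ha, sum_occupied, charHom_J,
      add_smul, Module.algebraMap_end_apply]
    intro x y hxy
    left
    rw [blockDiagonal_apply] at hxy
    split_ifs at hxy with h
    · refine Prod.ext ?_ h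
      by_contra h'
      rw [evalVec_J, Matrix.smul_apply, chevH, diagonal_apply_ne _ h', smul_zero] at hxy
      exact hxy rfl
    · exact absurd rfl hxy

end

theorem exists_finiteDimensional_hwVector (p : Param Q) :
    vermaVec Q (weight Q p) ≠ 0 ∧ FiniteDimensional ℂ (Simple Q (weight Q p)) := by
  classical
  let R : Type := Σ i : Fin n, ((p i).1 : ℂ[X]).roots.ToType
  let γ : R → ℂ := fun r => r.2.1
  let β : Fin n → ℂ := fun i => (p i).2
  have hβ : ∀ i, Q i = 0 → β i = 0 := fun i => (p i).2.2
  obtain ⟨v, hv0, hX, hJ⟩ := exists_fockRep_highestWeight (Q := Q) (fun r : R => r.1) γ β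
  obtain ⟨Φ, hΦ⟩ := exists_algHom_of_rel Q (fockRep Q γ β) (fun a b h => fockRep_rel Q γ hβ h)
  let _ : Module (U Q) (Fock (Fin (n + 1) × R)) :=
    Module.compHom _ (Φ : U Q →+* Module.End ℂ (Fock (Fin (n + 1) × R)))
  have hsmul : ∀ (a : U Q) (x : Fock (Fin (n + 1) × R)), a • x = Φ a x := fun _ _ => rfl
  have : IsScalarTower ℂ (U Q) (Fock (Fin (n + 1) × R)) :=
    ⟨fun c a x => by rw [hsmul, hsmul, map_smul, LinearMap.smul_apply]⟩
  have hv : IsHWVector Q (weight Q p) v := by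
    refine ⟨fun i t => ?_, fun i t => ?_⟩
    · rw [hsmul, U.Xp, hΦ, hX]
    · rw [algebraMap_smul, hsmul, U.J, hΦ, hJ, weight_eq]
      congr 2
      rw [Fintype.sum_sigma, Finset.sum_eq_single i]
      · simp only [if_true, powerSum]
        rw [← Multiset.map_univ]
        rfl
      · intro j _ hj
        simp [hj]
      · simp
  exact ⟨vermaVec_ne_zero_of_isHWVector hv hv0, finiteDimensional_simple hv hv0⟩

/-! ### The parameters are determined by the weight -/

/-- The multiplicity of a root is read off by a polynomial that vanishes at all other points of
evaluation. -/
theorem param_eq_of_weight_eq {p p' : Param Q} (h : ∀ i t, weight Q p i t = weight Q p' i t) :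
    p = p' := by
  classical
  -- both weights, as functionals on polynomials: evaluations at the roots and at `Q_i⁻¹`
  have hfun : ∀ (p : Param Q) (i : Fin n) (f : ℂ[X]), f.sum (fun t a => a * weight Q p i t) =
      (((p i).1 : ℂ[X]).roots.map (fun γ => f.eval γ)).sum + f.eval (Q i)⁻¹ * ((p i).2 : ℂ) := by
    intro p i f
    induction f using Polynomial.induction_on' with
    | add f g hf hg =>
      rw [Polynomial.sum_add_index _ _ _ (by simp) (by intros; ring), hf, hg]
      simp only [eval_add, Multiset.sum_map_add]
      ring
    | monomial t a =>
      rw [Polynomial.sum_monomial_index _ _ (by simp), weight_eq, powerSum]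
      simp only [eval_monomial, Multiset.sum_map_mul_left, inv_pow]
      ring
  have hroots : ∀ i, ((p i).1 : ℂ[X]).roots = ((p' i).1 : ℂ[X]).roots := by
    intro i
    ext γ
    by_cases hγ : Q i ≠ 0 ∧ γ = (Q i)⁻¹
    · have hz : ∀ p : Param Q, ((p i).1 : ℂ[X]).roots.count γ = 0 := by
        intro p
        rw [count_roots, rootMultiplicity_eq_zero]
        rw [hγ.2]
        exact (p i).1.2.2 hγ.1
      rw [hz, hz]
    · -- a polynomial that vanishes at the other points of evaluation
      set T : Finset ℂ := (insert (Q i)⁻¹ (((p i).1 : ℂ[X]).roots.toFinset ∪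
        ((p' i).1 : ℂ[X]).roots.toFinset)).erase γ with hT
      set f : ℂ[X] := ∏ t ∈ T, (X - C t) with hf
      have hf0 : f.eval γ ≠ 0 := by
        rw [hf, eval_prod, Finset.prod_ne_zero_iff]
        intro t ht
        rw [eval_sub, eval_X, eval_C, sub_ne_zero]
        exact (Finset.ne_of_mem_erase ht).symm
      have hfT : ∀ t ∈ T, f.eval t = 0 := by
        intro t ht
        rw [hf, eval_prod]
        exact Finset.prod_eq_zero ht (by simp)
      have hval : ∀ q : Param Q, (q = p ∨ q = p') →
          f.sum (fun t a => a * weight Q q i t) =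
            ((q i).1 : ℂ[X]).roots.count γ * f.eval γ := by
        intro q hq
        have hβ : f.eval (Q i)⁻¹ * ((q i).2 : ℂ) = 0 := by
          by_cases h0 : Q i = 0
          · rw [(q i).2.2 h0, mul_zero]
          · rw [hfT, zero_mul]
            rw [hT, Finset.mem_erase]
            exact ⟨fun h => hγ ⟨h0, h.symm⟩, Finset.mem_insert_self _ _⟩
        rw [hfun, hβ, add_zero, Finset.sum_multiset_map_count, Finset.sum_eq_single γ]
        · rw [nsmul_eq_mul]
        · intro b hb hbγ
          rw [hfT, smul_zero]
          rw [hT, Finset.mem_erase]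
          refine ⟨hbγ, Finset.mem_insert_of_mem ?_⟩
          rcases hq with rfl | rfl
          · exact Finset.mem_union_left _ hb
          · exact Finset.mem_union_right _ hb
        · intro hγ'
          rw [Multiset.mem_toFinset] at hγ'
          rw [Multiset.count_eq_zero_of_notMem hγ', zero_smul]
      have heq := (hval p (Or.inl rfl)).symm.trans ((by simp only [h]) :
        f.sum (fun t a => a * weight Q p i t) = f.sum (fun t a => a * weight Q p' i t)) |>.trans
        (hval p' (Or.inr rfl))
      exact_mod_cast mul_right_cancel₀ hf0 heq
  have hφ : ∀ i, ((p i).1 : ℂ[X]) = ((p' i).1 : ℂ[X]) := by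
    intro i
    rw [(IsAlgClosed.splits ((p i).1 : ℂ[X])).eq_prod_roots_of_monic (p i).1.2.1,
      (IsAlgClosed.splits ((p' i).1 : ℂ[X])).eq_prod_roots_of_monic (p' i).1.2.1, hroots i]
  funext i
  refine Prod.ext (Subtype.ext (hφ i)) (Subtype.ext ?_)
  have h0 := h i 0
  rw [weight_eq, weight_eq, hφ i] at h0
  simpa using h0

end FockHighestWeight

/-! ### Generating functions of the generators -/

section PolyExt

variable {A : Type*} [AddCommGroup A] [Module ℂ A]

/-- The linear map on `ℂ[X]` that sends `X ^ t` to `F t`. -/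
def polyExt (F : ℕ → A) : ℂ[X] →ₗ[ℂ] A :=
  Polynomial.lsum fun t => LinearMap.toSpanSingleton ℂ A (F t)

theorem polyExt_monomial (F : ℕ → A) (t : ℕ) (a : ℂ) : polyExt F (monomial t a) = a • F t := by
  rw [polyExt, Polynomial.lsum_apply, Polynomial.sum_monomial_index _ _ (by simp)]
  simp

theorem polyExt_X_pow (F : ℕ → A) (t : ℕ) : polyExt F (X ^ t) = F t := by
  rw [← monomial_one_right_eq_X_pow, polyExt_monomial, one_smul]

variable {n : ℕ} (Q : Fin n → ℂ) (i : Fin n)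

/-- `X⁺_i(f)`, linear in the polynomial `f`, with `X⁺_i(x^t) = X⁺_{i,t}`. -/
def polyXp : ℂ[X] →ₗ[ℂ] U Q := polyExt (U.Xp Q i)

/-- `X⁻_i(f)`, linear in the polynomial `f`, with `X⁻_i(x^t) = X⁻_{i,t}`. -/
def polyXm : ℂ[X] →ₗ[ℂ] U Q := polyExt (U.Xm Q i)

/-- `J_i(f)`, linear in the polynomial `f`, with `J_i(x^t) = J_{i,t}`. -/
def polyJ : ℂ[X] →ₗ[ℂ] U Q := polyExt (U.J Q i)

theorem polyXp_mul_polyXm (f g : ℂ[X]) : polyXp Q i g * polyXm Q i f =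
    polyXm Q i f * polyXp Q i g + polyJ Q i ((1 - C (Q i) * X) * (f * g)) := by
  induction f using Polynomial.induction_on' with
  | add f f' h h' => simp only [mul_add, add_mul, map_add, h, h']; abel
  | monomial s a =>
    induction g using Polynomial.induction_on' with
    | add g g' h h' => simp only [mul_add, add_mul, map_add, h, h']; abel
    | monomial t b =>
      have : (1 - C (Q i) * X) * (monomial s a * monomial t b) =
          monomial (s + t) (a * b) - monomial (s + t + 1) (Q i * (a * b)) := by
        rw [monomial_mul_monomial, sub_mul, one_mul, mul_assoc, X_mul_monomial, C_mul_monomial]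
      rw [this, map_sub]
      simp only [polyXp, polyXm, polyJ, polyExt_monomial, smul_mul_smul_comm, U.Xp_mul_Xm_same]
      module

theorem polyJ_mul_polyXm (f g : ℂ[X]) : polyJ Q i g * polyXm Q i f =
    polyXm Q i f * polyJ Q i g - (2 : ℂ) • polyXm Q i (g * f) := by
  induction f using Polynomial.induction_on' with
  | add f f' h h' => simp only [mul_add, add_mul, map_add, h, h', smul_add]; abel
  | monomial s a =>
    induction g using Polynomial.induction_on' with
    | add g g' h h' => simp only [mul_add, add_mul, map_add, h, h', smul_add]; abel
    | monomial t b =>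
      have hc : cartan i i = 2 := if_pos rfl
      rw [monomial_mul_monomial]
      simp only [polyXm, polyJ, polyExt_monomial, smul_mul_smul_comm, U.J_mul_Xm, hc]
      module

theorem polyXm_mul_polyXm (f g : ℂ[X]) :
    polyXm Q i g * polyXm Q i f = polyXm Q i f * polyXm Q i g := by
  induction f using Polynomial.induction_on' with
  | add f f' h h' => simp only [mul_add, add_mul, map_add, h, h']
  | monomial s a =>
    induction g using Polynomial.induction_on' with
    | add g g' h h' => simp only [mul_add, add_mul, map_add, h, h']
    | monomial t b =>
      simp only [polyXm, polyExt_monomial, smul_mul_smul_comm, U.Xm_mul_Xm_same Q i s t]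
      rw [mul_comm]

theorem Xp_mul_polyXm_ne {i j : Fin n} (hij : i ≠ j) (f : ℂ[X]) (t : ℕ) :
    U.Xp Q j t * polyXm Q i f = polyXm Q i f * U.Xp Q j t := by
  induction f using Polynomial.induction_on' with
  | add f f' h h' => simp only [mul_add, add_mul, map_add, h, h']
  | monomial s a =>
    simp only [polyXm, polyExt_monomial, smul_mul_assoc, mul_smul_comm,
      U.Xp_mul_Xm_ne Q hij.symm]

theorem ht_mul_polyXm (f : ℂ[X]) : ht Q * polyXm Q i f = polyXm Q i f * ht Q - polyXm Q i f := by
  induction f using Polynomial.induction_on' with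
  | add f f' h h' => simp only [mul_add, add_mul, map_add, h, h']; abel
  | monomial s a =>
    simp only [polyXm, polyExt_monomial, smul_mul_assoc, mul_smul_comm, ht_mul_Xm, smul_sub]

end PolyExt

/-! ### Highest weights of finite dimensional simple modules -/

section RankOne

variable {n : ℕ} {Q : Fin n → ℂ} {u : Fin n → ℕ → ℂ} {V : Type*} [AddCommGroup V] [Module ℂ V]
  [Module (U Q) V] [IsScalarTower ℂ (U Q) V] {v : V}

/-- In finite dimension a chain of height vectors with heights `μ`, `μ - 1`, `μ - 2`, … stops. -/
theorem exists_eq_zero_of_ht_smul [FiniteDimensional ℂ V] {μ : ℂ} (y : ℕ → V)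
    (hy : ∀ r, ht Q • y r = (μ - r) • y r) : ∃ r, y r = 0 := by
  by_contra! h0
  have hfin := Module.End.finite_hasEigenvalue (Algebra.lsmul ℂ ℂ V (ht Q))
  refine Set.infinite_of_injective_forall_mem (f := fun r : ℕ => μ - r) ?_ ?_ hfin
  · intro r s hrs
    exact_mod_cast sub_right_injective hrs
  · intro r
    exact Module.End.hasEigenvalue_of_hasEigenvector
      (x := y r) ⟨Module.End.mem_eigenspace_iff.2 (hy r), h0 r⟩

/-- A finite dimensional module has a highest weight vector: take an eigenspace of the height element
that no `X⁺_{i,t}` can raise, and a common eigenvector of the `J_{i,t}` in it. -/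
theorem exists_isHWVector [FiniteDimensional ℂ V] [Nontrivial V] :
    ∃ (u : Fin n → ℕ → ℂ) (v : V), v ≠ 0 ∧ IsHWVector Q u v := by
  -- an eigenvalue of maximal real part: no `μ + 1` is an eigenvalue
  set H : Module.End ℂ V := Algebra.lsmul ℂ ℂ V (ht Q) with hH
  obtain ⟨μ₀, hμ₀⟩ := Module.End.exists_eigenvalue H
  obtain ⟨μ, hμ, hmax⟩ := Set.exists_max_image {μ | H.HasEigenvalue μ} Complex.re
    (Module.End.finite_hasEigenvalue H) ⟨μ₀, hμ₀⟩
  have hXp : ∀ x ∈ H.eigenspace μ, ∀ i t, U.Xp Q i t • x = 0 := by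
    intro x hx i t
    by_contra h0
    have hx' : ht Q • x = μ • x := Module.End.mem_eigenspace_iff.1 hx
    have : H.HasEigenvalue (μ + 1) := by
      refine Module.End.hasEigenvalue_of_hasEigenvector
        (x := U.Xp Q i t • x) ⟨Module.End.mem_eigenspace_iff.2 ?_, h0⟩
      change ht Q • U.Xp Q i t • x = _
      rw [smul_smul, ht_mul_Xp, add_smul, mul_smul, hx', smul_comm, add_smul, one_smul]
    have := hmax _ this
    simp at this
    linarith
  -- a minimal nonzero subspace stable under the `J_{i,t}` consists of common eigenvectors
  let P : ℕ → Prop := fun d => ∃ S : Submodule ℂ V, S ≠ ⊥ ∧ S ≤ H.eigenspace μ ∧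
    (∀ i t, ∀ x ∈ S, U.J Q i t • x ∈ S) ∧ Module.finrank ℂ S = d
  have hP : ∃ d, P d := by
    refine ⟨_, H.eigenspace μ, hμ, le_rfl, ?_, rfl⟩
    intro i t x hx
    have hx' : ht Q • x = μ • x := Module.End.mem_eigenspace_iff.1 hx
    refine Module.End.mem_eigenspace_iff.2 ?_
    change ht Q • U.J Q i t • x = _
    rw [smul_smul, ht_mul_J, mul_smul, hx', smul_comm]
  classical
  obtain ⟨S, hS0, hSμ, hSJ, hSd⟩ := Nat.find_spec hP
  have hmin := fun d (hd : d < Nat.find hP) => Nat.find_min hP hd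
  obtain ⟨v, hvS, hv0⟩ := Submodule.exists_mem_ne_zero_of_ne_bot hS0
  have hscal : ∀ i t, ∃ c : ℂ, U.J Q i t • v = c • v := by
    intro i t
    have : Nontrivial S := Submodule.nontrivial_iff_ne_bot.2 hS0
    let T : Module.End ℂ V := Algebra.lsmul ℂ ℂ V (U.J Q i t)
    obtain ⟨c, hc⟩ := Module.End.exists_eigenvalue (T.restrict (hSJ i t))
    obtain ⟨⟨w, hwS⟩, hw, hw0⟩ := hc.exists_hasEigenvector
    have hw' : T w = c • w := congrArg Subtype.val (Module.End.mem_eigenspace_iff.1 hw)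
    have hS' : S ⊓ T.eigenspace c = S := by
      refine Submodule.eq_of_le_of_finrank_le inf_le_left ?_
      by_contra hlt
      rw [not_le, hSd] at hlt
      refine hmin _ hlt ⟨S ⊓ T.eigenspace c, ?_, inf_le_left.trans hSμ, ?_, rfl⟩
      · intro hbot
        have : w ∈ S ⊓ T.eigenspace c := ⟨hwS, Module.End.mem_eigenspace_iff.2 hw'⟩
        rw [hbot, Submodule.mem_bot] at this
        exact hw0 (Subtype.ext this)
      · intro j s x hx
        refine ⟨hSJ j s x hx.1, Module.End.mem_eigenspace_iff.2 ?_⟩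
        have hx2 : U.J Q i t • x = c • x := Module.End.mem_eigenspace_iff.1 hx.2
        change U.J Q i t • U.J Q j s • x = _
        rw [smul_smul, U.J_mul_J, mul_smul, hx2, smul_comm]
    rw [← hS'] at hvS
    exact ⟨c, Module.End.mem_eigenspace_iff.1 hvS.2⟩
  choose u hu using hscal
  exact ⟨u, v, hv0, fun i t => hXp v (hSμ hvS) i t, fun i t => by rw [hu, algebraMap_smul]⟩

theorem IsHWVector.polyXp_smul (hv : IsHWVector Q u v) (i : Fin n) (f : ℂ[X]) :
    polyXp Q i f • v = 0 := by
  induction f using Polynomial.induction_on' with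
  | add f f' h h' => rw [map_add, add_smul, h, h', add_zero]
  | monomial s a => rw [polyXp, polyExt_monomial, smul_assoc, hv.Xp_smul, smul_zero]

theorem IsHWVector.polyJ_smul (hv : IsHWVector Q u v) (i : Fin n) (f : ℂ[X]) :
    polyJ Q i f • v = polyExt (u i) f • v := by
  induction f using Polynomial.induction_on' with
  | add f f' h h' => rw [map_add, add_smul, h, h', map_add, add_smul]
  | monomial s a =>
    rw [polyJ, polyExt_monomial, smul_assoc, hv.J_smul, algebraMap_smul, polyExt_monomial,
      smul_assoc]

/-- The functional through which the commutators `[X⁺_i(g), X⁻_i(f)]` act on a highest weight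
vector, as a function of `f g`. -/
def coweight (Q : Fin n → ℂ) (u : Fin n → ℕ → ℂ) (i : Fin n) : ℂ[X] →ₗ[ℂ] ℂ :=
  polyExt (u i) ∘ₗ LinearMap.mulLeft ℂ (1 - C (Q i) * X)

theorem coweight_apply (i : Fin n) (f : ℂ[X]) :
    coweight Q u i f = polyExt (u i) ((1 - C (Q i) * X) * f) := rfl

theorem IsHWVector.polyXp_smul_polyXm_smul (hv : IsHWVector Q u v) (i : Fin n) (f g : ℂ[X]) :
    polyXp Q i g • polyXm Q i f • v = coweight Q u i (f * g) • v := by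
  rw [smul_smul, polyXp_mul_polyXm, add_smul, mul_smul, hv.polyXp_smul, smul_zero, zero_add,
    hv.polyJ_smul, coweight_apply]

theorem IsHWVector.ht_smul_polyXm_pow_smul (hv : IsHWVector Q u v) (i : Fin n) (f : ℂ[X]) (r : ℕ) :
    ht Q • polyXm Q i f ^ r • v = (topHeight u - r) • polyXm Q i f ^ r • v := by
  induction r with
  | zero => simp [hv.ht_smul]
  | succ r ih =>
    rw [pow_succ', mul_smul, smul_smul, ht_mul_polyXm, sub_smul, mul_smul, ih,
      smul_comm (polyXm Q i f) (topHeight u - (r : ℂ)) (_ : V)]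
    generalize polyXm Q i f • polyXm Q i f ^ r • v = z
    push_cast
    module

/-- The annihilator of a highest weight vector under `f ↦ X⁻_i(f)`; it is an ideal because of the
action of the `J_i(g)`. -/
def annIdeal (hv : IsHWVector Q u v) (i : Fin n) : Ideal ℂ[X] where
  carrier := {f | polyXm Q i f • v = 0}
  zero_mem' := by simp
  add_mem' := by
    intro f g hf hg
    simp only [Set.mem_ofPred_eq] at hf hg ⊢
    rw [map_add, add_smul, hf, hg, add_zero]
  smul_mem' := by
    intro g f hf
    simp only [Set.mem_ofPred_eq] at hf ⊢
    have h : (2 : ℂ) • polyXm Q i (g * f) = polyXm Q i f * polyJ Q i g -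
        polyJ Q i g * polyXm Q i f := by
      rw [polyJ_mul_polyXm]; abel
    have h2 : (2 : ℂ) • polyXm Q i (g * f) • v = 0 := by
      rw [← smul_assoc, h, sub_smul, mul_smul, mul_smul, hf, hv.polyJ_smul, smul_comm, hf,
        smul_zero, smul_zero, sub_zero]
    exact (smul_eq_zero.1 h2).resolve_left two_ne_zero

theorem mem_annIdeal (hv : IsHWVector Q u v) {i : Fin n} {f : ℂ[X]} :
    f ∈ annIdeal hv i ↔ polyXm Q i f • v = 0 := Iff.rfl

theorem annIdeal_ne_bot [FiniteDimensional ℂ V] (hv : IsHWVector Q u v) (i : Fin n) :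
    annIdeal hv i ≠ ⊥ := by
  intro h
  let T : ℂ[X] →ₗ[ℂ] V :=
    { toFun := fun f => polyXm Q i f • v
      map_add' := fun f g => by rw [map_add, add_smul]
      map_smul' := fun c f => by rw [map_smul, smul_assoc]; rfl }
  have hT : Function.Injective T := by
    rw [injective_iff_map_eq_zero]
    intro f hf
    have : f ∈ annIdeal hv i := hf
    rwa [h, Ideal.mem_bot] at this
  have := FiniteDimensional.of_injective T hT
  exact Polynomial.not_finite (R := ℂ) this

/-- In a simple module, a vector `X⁻_i(f) v` killed by all `X⁺_i(g)` is zero: it is singular and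
has smaller height than `v`, so it does not generate `v`. -/
theorem mem_annIdeal_of_coweight [IsSimpleModule (U Q) V] (hv : IsHWVector Q u v) (h0 : v ≠ 0)
    {i : Fin n} {f : ℂ[X]} (hf : ∀ g, coweight Q u i (f * g) = 0) : f ∈ annIdeal hv i := by
  rw [mem_annIdeal]
  by_contra hne
  let Y : Submodule ℂ V :=
    { carrier := {y | (∀ j t, U.Xp Q j t • y = 0) ∧ ht Q • y = (topHeight u - 1) • y}
      zero_mem' := by simp
      add_mem' := by
        rintro a b ⟨ha, ha'⟩ ⟨hb, hb'⟩
        refine ⟨fun j t => ?_, ?_⟩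
        · rw [smul_add, ha, hb, add_zero]
        · rw [smul_add, ha', hb', smul_add]
      smul_mem' := by
        rintro c a ⟨ha, ha'⟩
        refine ⟨fun j t => ?_, ?_⟩
        · rw [smul_comm, ha, smul_zero]
        · rw [smul_comm, ha', smul_comm] }
  have hY : IsSingular Q Y (topHeight u - 1) := by
    refine ⟨fun y hy => hy.1, fun y hy i t => ⟨fun j s => ?_, ?_⟩, fun y hy => hy.2⟩
    · have h : U.Xp Q j s * U.J Q i t = U.J Q i t * U.Xp Q j s - cartan i j • U.Xp Q j (t + s) := by
        rw [U.J_mul_Xp]; abel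
      rw [smul_smul, h, sub_smul, mul_smul, smul_assoc, hy.1, hy.1, smul_zero, smul_zero, sub_zero]
    · rw [smul_smul, ht_mul_J, mul_smul, hy.2, smul_comm]
  have hfY : polyXm Q i f • v ∈ Y := by
    refine ⟨fun j t => ?_, ?_⟩
    · by_cases hij : i = j
      · subst hij
        have h := hv.polyXp_smul_polyXm_smul i f (X ^ t)
        rwa [hf, zero_smul, polyXp, polyExt_X_pow] at h
      · rw [smul_smul, Xp_mul_polyXm_ne Q hij, mul_smul, hv.Xp_smul, smul_zero]
    · have h := hv.ht_smul_polyXm_pow_smul i f 1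
      simpa using h
  have htop : Submodule.span (U Q) (Y : Set V) = ⊤ := by
    refine (eq_bot_or_eq_top _).resolve_left fun hbot => hne ?_
    have := Submodule.subset_span (R := U Q) (s := (Y : Set V)) hfY
    rwa [hbot] at this
  obtain ⟨k, hk⟩ := hY.exists_eq_sub_of_ht_smul h0 (htop ▸ Submodule.mem_top) hv.ht_smul
  have : ((k + 1 : ℕ) : ℂ) = 0 := by push_cast; linear_combination hk
  exact Nat.cast_ne_zero.2 (Nat.succ_ne_zero k) this

/-- The `sl_2` computation: modulo the annihilator of `v`, the operators `X⁺_i(g)` and `X⁻_i(f)`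
move along the string `X⁻_i(f)^r v` as in an `sl_2`-module, with the usual coefficients. -/
theorem IsHWVector.polyXp_smul_polyXm_pow_smul (hv : IsHWVector Q u v) {i : Fin n} {f g : ℂ[X]}
    {d : ℂ} (hd : (1 - C (Q i) * X) * (f * g) * f - C d * f ∈ annIdeal hv i) (r : ℕ) :
    polyXp Q i g • polyXm Q i f ^ (r + 1) • v =
      (((r : ℂ) + 1) * (coweight Q u i (f * g) - r * d)) • polyXm Q i f ^ r • v := by
  set h := (1 - C (Q i) * X) * (f * g) with hh
  have hcomm : ∀ r, polyXm Q i (h * f) • polyXm Q i f ^ r • v = d • polyXm Q i f ^ (r + 1) • v := by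
    intro r
    have h1 : Commute (polyXm Q i (h * f)) (polyXm Q i f ^ r) :=
      Commute.pow_right (polyXm_mul_polyXm Q i _ _) r
    rw [smul_smul, h1.eq, mul_smul]
    have h2 : polyXm Q i (h * f) • v = d • polyXm Q i f • v := by
      have h3 := mem_annIdeal hv |>.1 hd
      rw [map_sub, sub_smul, sub_eq_zero] at h3
      rw [h3, ← smul_eq_C_mul, map_smul, smul_assoc]
    rw [h2, smul_comm, pow_succ, mul_smul]
  have hJ : ∀ r : ℕ, polyJ Q i h • polyXm Q i f ^ r • v =
      (coweight Q u i (f * g) - 2 * r * d) • polyXm Q i f ^ r • v := by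
    intro r
    induction r with
    | zero => simp [hv.polyJ_smul, coweight_apply, hh]
    | succ r ih =>
      have h1 := hcomm r
      rw [pow_succ', mul_smul, smul_smul, polyJ_mul_polyXm, sub_smul, mul_smul, ih, smul_assoc, h1,
        pow_succ', mul_smul, smul_comm (polyXm Q i f) (_ : ℂ) (_ : V)]
      generalize polyXm Q i f • polyXm Q i f ^ r • v = z
      push_cast
      module
  induction r with
  | zero => simp [hv.polyXp_smul_polyXm_smul]
  | succ r ih =>
    rw [pow_succ', mul_smul, smul_smul, polyXp_mul_polyXm, add_smul, mul_smul, ih, hJ,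
      smul_comm (polyXm Q i f) (_ : ℂ) (_ : V), smul_smul, ← pow_succ']
    generalize polyXm Q i f ^ (r + 1) • v = z
    push_cast
    module

/-- Finiteness of the strings `X⁻_i(f)^r v` quantizes the coweight. -/
theorem exists_coweight_eq_nat_mul [FiniteDimensional ℂ V] (hv : IsHWVector Q u v) (h0 : v ≠ 0)
    {i : Fin n} {f g : ℂ[X]} {d : ℂ}
    (hd : (1 - C (Q i) * X) * (f * g) * f - C d * f ∈ annIdeal hv i) :
    ∃ r : ℕ, coweight Q u i (f * g) = r * d := by
  by_contra! hne
  obtain ⟨r, hr⟩ := exists_eq_zero_of_ht_smul _ (hv.ht_smul_polyXm_pow_smul i f)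
  induction r with
  | zero => simp [h0] at hr
  | succ r ih =>
    have h := hv.polyXp_smul_polyXm_pow_smul hd r
    rw [hr, smul_zero] at h
    refine ih ((smul_eq_zero.1 h.symm).resolve_left (mul_ne_zero ?_ ?_))
    · exact_mod_cast Nat.succ_ne_zero r
    · exact sub_ne_zero.2 (hne r)

/-- If `f²` annihilates, the string `X⁻_i(f)^r v` behaves as for a Heisenberg algebra, so by
finiteness its central charges `w(f g)` vanish. -/
theorem isRadical_annIdeal [FiniteDimensional ℂ V] [IsSimpleModule (U Q) V]
    (hv : IsHWVector Q u v) (h0 : v ≠ 0) {i : Fin n} {f : ℂ[X]} (hf : f * f ∈ annIdeal hv i) :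
    f ∈ annIdeal hv i := by
  refine mem_annIdeal_of_coweight hv h0 fun g => ?_
  obtain ⟨r, hr⟩ := exists_coweight_eq_nat_mul (i := i) (f := f) (g := g) (d := 0) hv h0 (by
    rw [map_zero, zero_mul, sub_zero,
      show (1 - C (Q i) * X) * (f * g) * f = ((1 - C (Q i) * X) * g) * (f * f) by ring]
    exact Ideal.mul_mem_left _ _ hf)
  rw [hr, mul_zero]

theorem coweight_eq_zero_of_mem_annIdeal (hv : IsHWVector Q u v) (h0 : v ≠ 0) {i : Fin n}
    {f : ℂ[X]} (hf : f ∈ annIdeal hv i) : coweight Q u i f = 0 := by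
  have h := hv.polyXp_smul_polyXm_smul i f 1
  rw [(mem_annIdeal hv).1 hf, smul_zero, mul_one] at h
  exact (smul_eq_zero.1 h.symm).resolve_right h0

/-- The annihilator of the highest weight vector of a finite dimensional simple module is the
vanishing ideal of a finite set of points. -/
theorem exists_finset_mem_annIdeal [FiniteDimensional ℂ V] [IsSimpleModule (U Q) V]
    (hv : IsHWVector Q u v) (h0 : v ≠ 0) (i : Fin n) :
    ∃ Z : Finset ℂ, ∀ f : ℂ[X], (∀ z ∈ Z, f.eval z = 0) → f ∈ annIdeal hv i := by
  obtain ⟨q, hq⟩ := (inferInstance : (annIdeal hv i).IsPrincipal).principal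
  rw [← Ideal.span] at hq
  have hmem : ∀ f, f ∈ annIdeal hv i ↔ q ∣ f := fun f => by rw [hq, Ideal.mem_span_singleton]
  have hq0 : q ≠ 0 := by
    rintro rfl
    exact annIdeal_ne_bot hv i (by rw [hq]; simp)
  have hrad : IsRadical q := by
    refine (isRadical_iff_pow_one_lt 2 one_lt_two).2 fun f hf => ?_
    rw [← hmem] at hf ⊢
    rw [pow_two] at hf
    exact isRadical_annIdeal hv h0 hf
  have hnodup : q.roots.Nodup := nodup_roots (PerfectField.separable_iff_squarefree.2
    ((isRadical_iff_squarefree_of_ne_zero hq0).1 hrad))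
  refine ⟨q.roots.toFinset, fun f hf => ?_⟩
  rw [hmem]
  by_cases hf0 : f = 0
  · rw [hf0]; exact dvd_zero _
  · refine (IsAlgClosed.splits q).dvd_of_roots_le_roots hq0 ?_
    rw [Multiset.le_iff_subset hnodup]
    intro z hz
    exact (mem_roots hf0).2 (hf z (Multiset.mem_toFinset.2 hz))

/-- The coweight is a combination of evaluations, with quantized coefficients. -/
theorem exists_coweight_eq_sum [FiniteDimensional ℂ V] [IsSimpleModule (U Q) V]
    (hv : IsHWVector Q u v) (h0 : v ≠ 0) (i : Fin n) :
    ∃ (Z : Finset ℂ) (N : ℂ → ℕ), ∀ f : ℂ[X],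
      coweight Q u i f = ∑ z ∈ Z, N z * ((1 - Q i * z) * f.eval z) := by
  classical
  obtain ⟨Z, hZ⟩ := exists_finset_mem_annIdeal hv h0 i
  let ℓ : ℂ → ℂ[X] := fun z => Lagrange.basis Z id z
  have hℓ : ∀ z ∈ Z, ∀ w ∈ Z, (ℓ z).eval w = if z = w then 1 else 0 := by
    intro z hz w hw
    split_ifs with h
    · subst h
      exact Lagrange.eval_basis_self (v := id) (Function.injective_id.injOn) hz
    · exact Lagrange.eval_basis_of_ne (v := id) h hw
  have hN : ∀ z, ∃ r : ℕ, z ∈ Z → coweight Q u i (ℓ z) = r * (1 - Q i * z) := by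
    intro z
    by_cases hz : z ∈ Z
    · obtain ⟨r, hr⟩ := exists_coweight_eq_nat_mul (i := i) (f := ℓ z) (g := ℓ z)
        (d := 1 - Q i * z) hv h0 (hZ _ fun w hw => by
          simp only [eval_sub, eval_mul, eval_one, eval_C, eval_X, hℓ z hz w hw]
          split_ifs with h
          · rw [h]; ring
          · ring)
      refine ⟨r, fun _ => ?_⟩
      rw [← hr, ← sub_eq_zero, ← map_sub]
      refine coweight_eq_zero_of_mem_annIdeal hv h0 (hZ _ fun w hw => ?_)
      simp only [eval_sub, eval_mul, hℓ z hz w hw]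
      split_ifs <;> ring
    · exact ⟨0, fun h => absurd h hz⟩
  choose N hN using hN
  refine ⟨Z, N, fun f => ?_⟩
  have hf : coweight Q u i (f - ∑ z ∈ Z, f.eval z • ℓ z) = 0 := by
    refine coweight_eq_zero_of_mem_annIdeal hv h0 (hZ _ fun w hw => ?_)
    rw [eval_sub, eval_finsetSum, Finset.sum_eq_single w]
    · simp [hℓ w hw w hw]
    · intro z hz hzw
      simp [hℓ z hz w hw, hzw]
    · exact fun h => absurd hw h
  rw [map_sub, sub_eq_zero] at hf
  rw [hf, map_sum]
  refine Finset.sum_congr rfl fun z hz => ?_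
  rw [map_smul, hN z hz, smul_eq_mul]
  ring

theorem powerSum_prod (Z : Finset ℂ) (N : ℂ → ℕ) (t : ℕ) :
    powerSum (∏ z ∈ Z, (X - C z) ^ N z) t = ∑ z ∈ Z, N z * z ^ t := by
  induction Z using Finset.cons_induction with
  | empty => simp [powerSum]
  | cons z Z hz ih =>
    have h0 : (X - C z) ^ N z * ∏ z ∈ Z, (X - C z) ^ N z ≠ 0 :=
      mul_ne_zero (pow_ne_zero _ (X_sub_C_ne_zero z))
        (Finset.prod_ne_zero_iff.2 fun z _ => pow_ne_zero _ (X_sub_C_ne_zero z))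
    rw [powerSum] at ih
    rw [powerSum, Finset.prod_cons, Finset.sum_cons, roots_mul h0, Multiset.map_add,
      Multiset.sum_add, ih, roots_pow, roots_X_sub_C, Multiset.map_nsmul, Multiset.sum_nsmul]
    simp

/-- The highest weight of a finite dimensional simple module is one of the weights `u(φ, β)`. -/
theorem exists_param_of_isHWVector [FiniteDimensional ℂ V] [IsSimpleModule (U Q) V]
    (hv : IsHWVector Q u v) (h0 : v ≠ 0) : ∃ p : Param Q, u = weight Q p := by
  classical
  have key : ∀ i, ∃ p : MonicSet (Q i) × BSet (Q i),
      ∀ t, u i t = powerSum p.1 t + ((Q i) ^ t)⁻¹ * (p.2 : ℂ) := by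
    intro i
    obtain ⟨Z, N, hZ⟩ := exists_coweight_eq_sum hv h0 i
    set Z' := Z.filter fun z => Q i * z ≠ 1 with hZ'
    have hφ : (∏ z ∈ Z', (X - C z) ^ N z) ∈ MonicSet (Q i) := by
      refine ⟨monic_prod_of_monic _ _ fun z _ => (monic_X_sub_C z).pow _, fun hQ => ?_⟩
      rw [IsRoot.def, eval_prod]
      refine Finset.prod_ne_zero_iff.2 fun z hz => ?_
      rw [eval_pow, eval_sub, eval_X, eval_C]
      refine pow_ne_zero _ (sub_ne_zero.2 fun h => (Finset.mem_filter.1 hz).2 ?_)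
      rw [← h, mul_inv_cancel₀ hQ]
    by_cases hQ : Q i = 0
    · refine ⟨⟨⟨_, hφ⟩, ⟨0, fun _ => rfl⟩⟩, fun t => ?_⟩
      have h := hZ (X ^ t)
      rw [coweight_apply, hQ, map_zero, zero_mul, sub_zero, one_mul, polyExt_X_pow] at h
      have hZZ : Z' = Z := by
        rw [hZ', hQ]
        simp
      rw [h, powerSum_prod, mul_zero, add_zero]
      refine Finset.sum_congr hZZ.symm fun z _ => ?_
      rw [zero_mul, sub_zero, one_mul, eval_pow, eval_X]
    · refine ⟨⟨⟨_, hφ⟩, ⟨u i 0 - ∑ z ∈ Z', (N z : ℂ), fun h => absurd h hQ⟩⟩, fun t => ?_⟩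
      -- `x^t - Q_i^{-t}` is a multiple of `1 - Q_i x`, and the coweight sees the quotient
      obtain ⟨g, hg⟩ : (1 - C (Q i) * X) ∣ (X ^ t - C ((Q i)⁻¹ ^ t) : ℂ[X]) := by
        have h1 : (X - C (Q i)⁻¹) ∣ (X ^ t - C ((Q i)⁻¹ ^ t) : ℂ[X]) := by
          rw [dvd_iff_isRoot]
          simp
        obtain ⟨g, hg⟩ := h1
        refine ⟨-C (Q i)⁻¹ * g, ?_⟩
        have h2 : C (Q i) * C (Q i)⁻¹ = (1 : ℂ[X]) := by
          rw [← C_mul, mul_inv_cancel₀ hQ, C_1]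
        rw [hg]
        linear_combination (-X * g) * h2
      have h := hZ g
      rw [coweight_apply, ← hg, map_sub, polyExt_X_pow, ← mul_one (C _), ← smul_eq_C_mul, map_smul,
        ← pow_zero X, polyExt_X_pow, smul_eq_mul] at h
      have hterm : ∀ z, (1 - Q i * z) * g.eval z = z ^ t - (Q i)⁻¹ ^ t := by
        intro z
        have := congrArg (eval z) hg
        simp only [eval_sub, eval_mul, eval_pow, eval_X, eval_C, eval_one] at this
        exact this.symm
      have hsum : ∑ z ∈ Z, (N z : ℂ) * ((1 - Q i * z) * g.eval z) =
          ∑ z ∈ Z', (N z : ℂ) * (z ^ t - (Q i)⁻¹ ^ t) := by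
        rw [hZ', Finset.sum_filter]
        refine Finset.sum_congr rfl fun z _ => ?_
        split_ifs with hz
        · rw [hterm]
        · rw [not_not.1 hz]; ring
      rw [hsum] at h
      simp only [mul_sub, Finset.sum_sub_distrib, ← Finset.sum_mul] at h
      rw [powerSum_prod, ← inv_pow]
      linear_combination h
  choose p hp using key
  exact ⟨p, funext fun i => funext fun t => by rw [hp, weight_eq]⟩

end RankOne

end DeformedCurrent

end

theorem mainTheorem1 (m : ℕ) (Q : Fin (m - 1) → ℂ) :
    -- each module is simple, finite dimensional, and has the prescribed highest weight
    (∀ p : DeformedCurrent.Param Q,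
      IsSimpleModule (DeformedCurrent.U Q)
          (DeformedCurrent.Simple Q (DeformedCurrent.weight Q p)) ∧
        DeformedCurrent.IsHighestWeight Q (DeformedCurrent.weight Q p)
          (DeformedCurrent.Simple Q (DeformedCurrent.weight Q p)) ∧
        FiniteDimensional ℂ (DeformedCurrent.Simple Q (DeformedCurrent.weight Q p))) ∧
    -- isomorphism happens exactly for equal parameters
    (∀ p p' : DeformedCurrent.Param Q,
      Nonempty (DeformedCurrent.Simple Q (DeformedCurrent.weight Q p)
          ≃ₗ[DeformedCurrent.U Q] DeformedCurrent.Simple Q (DeformedCurrent.weight Q p')) ↔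
        p = p') ∧
    -- every finite dimensional simple module occurs
    (∀ (V : Type*) [AddCommGroup V] [Module ℂ V] [Module (DeformedCurrent.U Q) V]
      [IsScalarTower ℂ (DeformedCurrent.U Q) V],
      IsSimpleModule (DeformedCurrent.U Q) V → FiniteDimensional ℂ V →
        ∃ p : DeformedCurrent.Param Q,
          Nonempty (V ≃ₗ[DeformedCurrent.U Q]
            DeformedCurrent.Simple Q (DeformedCurrent.weight Q p))) := by
  open DeformedCurrent in
  refine ⟨fun p => ?_, fun p p' => ⟨?_, ?_⟩, ?_⟩
  · obtain ⟨h0, hfin⟩ := exists_finiteDimensional_hwVector p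
    exact ⟨isSimpleModule_simple h0, ⟨simpleVec Q _, simpleVec_ne_zero h0, span_simpleVec,
      isHWVector_simpleVec.Xp_smul, isHWVector_simpleVec.J_smul⟩, hfin⟩
  · rintro ⟨e⟩
    have h := isHWVector_simpleVec.eq_of_equiv
      (simpleVec_ne_zero (exists_finiteDimensional_hwVector p).1) span_simpleVec
      isHWVector_simpleVec (simpleVec_ne_zero (exists_finiteDimensional_hwVector p').1)
      span_simpleVec e
    exact param_eq_of_weight_eq fun i t => congrFun (congrFun h i) t
  · rintro rfl
    exact ⟨LinearEquiv.refl _ _⟩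
  · intro V _ _ _ _ hV hfin
    have : Nontrivial V := IsSimpleModule.nontrivial (U Q) V
    obtain ⟨u, v, h0, hv⟩ := exists_isHWVector (Q := Q) (V := V)
    obtain ⟨p, rfl⟩ := exists_param_of_isHWVector hv h0
    exact ⟨p, nonempty_equiv_simple hv h0⟩
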